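/- Let $m\ge n$ be given. There are positive constants $c, c_1, c_2, c_3$, depending only on $m$ and $n$, such that the following holds. Let $A\in\mathbb R^{m\times n}$ have full column rank, $b\in\mathbb R^m$, let $x^*\neq 0$ be the minimizer of $\|b-Ax\|_2$, $r^*=b-Ax^*$, and let $\kappa(A)=\|A\|_2\|A^\dagger\|_2$. Let $u>0$ and $0<u_r\le u^2$ be two unit roundoffs with $c\,u\,\kappa(A)<1$. Arithmetic in precision $u$ (and likewise $u_r$) obeys the standard model: an operation $+,-,\times,/,\sqrt{\cdot}$ with exact result $z$ returns a number $\hat z$ with $\hat z=z(1+\delta)=z/(1+\varepsilon)$, $|\delta|,|\varepsilon|\le u$; sums may be evaluated in any order. Let $\hat R\in\mathbb R^{n\times n}$ be the triangular factor computed by Householder QR factorization of $A$ in precision $u$. Let $\hat x_0\in\mathbb R^n$ be arbitrary, and let $\hat x_1,\hat x_2,\dots$ be computed by iterative refinement with the semi-normal equations: given $\hat x_{i-1}$, compute $r=b-A\hat x_{i-1}$ and then $A^Tr$ in precision $u_r$ (the latter vector may then be rounded to precision $u$), solve $\hat R^T\hat R\,\delta x=A^Tr$ by forward and back substitution in precision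 $u$, and compute $\hat x_i=\hat x_{i-1}+\delta x$ in precision $u$. Then: 1. For every $i\ge 1$, $$\frac{\|x^*-\hat x_i\|_2}{\|x^*\|_2}\le c_1u\,\kappa(A)^2\frac{\|x^*-\hat x_{i-1}\|_2}{\|x^*\|_2}+u\frac{\|\hat x_i\|_2}{\|x^*\|_2}+c_2u_r\,\kappa(A)^2\frac{\|A\|_2\|\hat x_{i-1}\|_2+\|b\|_2}{\|A\|_2\|x^*\|_2}.$$ 2. Let $E_i=\|x^*-\hat x_i\|_2/\|x^*\|_2$, $\rho=2+\dfrac{\|r^*\|_2}{\|A\|_2\|x^*\|_2}$ and $\eta=u+c_2u_r\,\kappa(A)^2\rho$. If $c_1u\,\kappa(A)^2<1$, then for every $i\ge1$ we have $E_i\le c_1u\,\kappa(A)^2E_{i-1}+c_3\eta$, and $E_i<E_{i-1}$ whenever $E_{i-1}>c_3\eta$; moreover $E_i\le c_3\eta$ for all sufficiently large $i$. If in addition $u_r\,\kappa(A)^2\rho<u$, then $E_i\le c_3(1+c_2)u$ for all sufficiently large $i$. -/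

import Mathlib

open scoped Matrix Matrix.Norms.L2Operator

noncomputable section

/-! ### Norms, pseudoinverse, condition number, least squares

The scope `Matrix.Norms.L2Operator` makes `‖A‖` the spectral norm of a matrix `A`. -/

/-- Euclidean norm of a vector given by its coordinates. -/
def norm2 {ι : Type*} [Fintype ι] (v : ι → ℝ) : ℝ := ‖WithLp.toLp 2 v‖

/-- Moore-Penrose pseudoinverse of a matrix with linearly independent columns. -/
def pinv {m n : ℕ} (A : Matrix (Fin m) (Fin n) ℝ) : Matrix (Fin n) (Fin m) ℝ :=
  (Aᵀ * A)⁻¹ * Aᵀ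

/-- The four Penrose equations, which characterize the pseudoinverse. -/
theorem pinv_penrose {m n : ℕ} (A : Matrix (Fin m) (Fin n) ℝ) (hA : A.rank = n) :
    A * pinv A * A = A ∧ pinv A * A * pinv A = pinv A ∧
      (A * pinv A)ᵀ = A * pinv A ∧ (pinv A * A)ᵀ = pinv A * A := by
  have hr : (Aᵀ * A).rank = n := by rw [Matrix.rank_transpose_mul_self, hA]
  have hdet : IsUnit (Aᵀ * A).det := by
    rw [← Matrix.isUnit_iff_isUnit_det, ← Matrix.mulVec_surjective_iff_isUnit]
    have htop : LinearMap.range (Aᵀ * A).mulVecLin = ⊤ := by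
      apply Submodule.eq_top_of_finrank_eq
      rw [← Matrix.rank, hr]
      simp
    exact LinearMap.range_eq_top.mp htop
  have h1 : pinv A * A = 1 := by
    rw [pinv, Matrix.mul_assoc, Matrix.nonsing_inv_mul _ hdet]
  refine ⟨by rw [Matrix.mul_assoc, h1, Matrix.mul_one], by rw [h1, Matrix.one_mul], ?_, ?_⟩
  · simp only [pinv, Matrix.transpose_mul, Matrix.transpose_transpose,
      Matrix.transpose_nonsing_inv, Matrix.mul_assoc]
  · rw [h1, Matrix.transpose_one]

/-- 2-norm condition number `κ(A) = ‖A‖₂ ‖A†‖₂`. -/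
def kappa {m n : ℕ} (A : Matrix (Fin m) (Fin n) ℝ) : ℝ := ‖A‖ * ‖pinv A‖

/-- `x` minimizes `‖b - A y‖₂` over all `y`. -/
def IsLeastSquaresSolution {m n : ℕ} (A : Matrix (Fin m) (Fin n) ℝ) (b : Fin m → ℝ)
    (x : Fin n → ℝ) : Prop :=
  ∀ y : Fin n → ℝ, norm2 (b - A *ᵥ x) ≤ norm2 (b - A *ᵥ y)

/-! ### Standard model of floating point arithmetic -/

/-- `z` is an admissible result of an elementary operation with exact result `x` in an arithmetic
with unit roundoff `u`: the standard model in both of its usual forms, `z = x (1 + δ)` with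
`|δ| ≤ u`, and `z = x / (1 + ε)` with `|ε| ≤ u`. -/
def Rounds (u x z : ℝ) : Prop := |z - x| ≤ u * |x| ∧ |z - x| ≤ u * |z|

/-- `FlSum u f S z`: `z` is a computed value of `∑ i ∈ S, f i`, the additions being done with
unit roundoff `u` and in an arbitrary order (one addition for each node of a binary tree whose
leaves are the elements of `S`). -/
inductive FlSum {ι : Type*} [DecidableEq ι] (u : ℝ) (f : ι → ℝ) : Finset ι → ℝ → Prop
  | empty : FlSum u f ∅ 0
  | single (i : ι) : FlSum u f {i} (f i)
  | add {S T : Finset ι} {s t z : ℝ} (hS : S.Nonempty) (hT : T.Nonempty) (hST : Disjoint S T)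
      (hs : FlSum u f S s) (ht : FlSum u f T t) (hz : Rounds u (s + t) z) :
      FlSum u f (S ∪ T) z

/-- `z` is a computed inner product `∑ j ∈ S, a j * y j`. -/
def FlDot {ι : Type*} [DecidableEq ι] (u : ℝ) (S : Finset ι) (a y : ι → ℝ) (z : ℝ) : Prop :=
  ∃ p : ι → ℝ, (∀ j ∈ S, Rounds u (a j * y j) (p j)) ∧ FlSum u p S z

/-- `z` is a computed value of `c - ∑ j ∈ S, a j * y j`; the index `none` carries `c`. -/
def FlSubDot {ι : Type*} [DecidableEq ι] (u : ℝ) (S : Finset ι) (c : ℝ) (a y : ι → ℝ)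
    (z : ℝ) : Prop :=
  ∃ p : ι → ℝ, (∀ j ∈ S, Rounds u (a j * y j) (p j)) ∧
    FlSum u (fun o : Option ι => o.elim c (fun j => -p j)) (Finset.insertNone S) z

/-- `ρ` is a computed value of `(∑ j ∈ S, (x j) ^ 2) ^ (1/2)`. -/
def FlNorm {ι : Type*} [DecidableEq ι] (u : ℝ) (S : Finset ι) (x : ι → ℝ) (ρ : ℝ) : Prop :=
  ∃ q : ℝ, FlDot u S x x q ∧ Rounds u (Real.sqrt q) ρ

/-! ### Householder QR factorization -/

/-- Computed data `v`, `s`, `β` of the Householder reflector `I - β v vᵀ` that maps the part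
`x_p, x_{p+1}, …` of `x` to a vector `(-s, 0, …, 0)`:
`s = sign(x_p) ‖(x_p, x_{p+1}, …)‖₂`, `v_p = x_p + s`, `v_i = x_i` for `i > p`,
`β = 1 / (s v_p)`. If that part of `x` is zero, the reflector is the identity. -/
def FlReflector {m : ℕ} (u : ℝ) (p : Fin m) (x v : Fin m → ℝ) (s β : ℝ) : Prop :=
  if ∀ i, p ≤ i → x i = 0 then v = 0 ∧ s = 0 ∧ β = 0
  else
    (∃ ρ, FlNorm u (Finset.Ici p) x ρ ∧ s = if 0 ≤ x p then ρ else -ρ) ∧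
    (∀ i, i < p → v i = 0) ∧ Rounds u (x p + s) (v p) ∧ (∀ i, p < i → v i = x i) ∧
    ∃ d, Rounds u (s * v p) d ∧ Rounds u (1 / d) β

/-- One computed step of Householder triangularization, from `B` to `B'`, with pivot row `p` and
pivot column `q`. The pivot column becomes `-s` in row `p` and zero below; a later column `y` is
overwritten by `y - (β (vᵀ y)) v`; rows above `p` and columns before `q` are not touched. -/
def FlHouseholderStep {m n : ℕ} (u : ℝ) (p : Fin m) (q : Fin n)
    (B B' : Matrix (Fin m) (Fin n) ℝ) : Prop :=
  ∃ (v : Fin m → ℝ) (s β : ℝ), FlReflector u p (fun i => B i q) v s β ∧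
    (∀ i j, i < p ∨ j < q → B' i j = B i j) ∧
    B' p q = -s ∧ (∀ i, p < i → B' i q = 0) ∧
    ∀ j, q < j → ∃ w t, FlDot u (Finset.Ici p) v (fun i => B i j) w ∧ Rounds u (β * w) t ∧
      ∀ i, p ≤ i → ∃ g, Rounds u (t * v i) g ∧ Rounds u (B i j - g) (B' i j)

/-- `R` is an `n × n` triangular factor computed by Householder QR factorization of `A` in
precision `u`. -/
def FlHouseholderQR {m n : ℕ} (hmn : n ≤ m) (u : ℝ) (A : Matrix (Fin m) (Fin n) ℝ)
    (R : Matrix (Fin n) (Fin n) ℝ) : Prop :=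
  ∃ B : ℕ → Matrix (Fin m) (Fin n) ℝ, B 0 = A ∧
    (∀ k : Fin n, FlHouseholderStep u (Fin.castLE hmn k) k (B k) (B (k + 1))) ∧
    ∀ i j, R i j = B n (Fin.castLE hmn i) j

/-! ### Iterative refinement with the semi-normal equations -/

/-- `y` is computed by forward substitution from `L y = g`, `L` lower triangular. -/
def FlForwardSubst {n : ℕ} (u : ℝ) (L : Matrix (Fin n) (Fin n) ℝ) (g y : Fin n → ℝ) : Prop :=
  ∀ i, ∃ z, FlSubDot u (Finset.Iio i) (g i) (L i) y z ∧ Rounds u (z / L i i) (y i)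

/-- `y` is computed by back substitution from `U y = g`, `U` upper triangular. -/
def FlBackSubst {n : ℕ} (u : ℝ) (U : Matrix (Fin n) (Fin n) ℝ) (g y : Fin n → ℝ) : Prop :=
  ∀ i, ∃ z, FlSubDot u (Finset.Ioi i) (g i) (U i) y z ∧ Rounds u (z / U i i) (y i)

/-- `x'` is computed from `x` by one step of two-precision refinement with the computed triangular
factor `R`:
* `r = b - A x` and `h = Aᵀ r` are computed in precision `ur`;
* `h` may be rounded to precision `u` (`g = h` is admissible as well);
* `Rᵀ y = g` and `R d = y` are solved by substitution in precision `u`;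
* `x' = x + d` is computed in precision `u`. -/
def FlSemiNormalStep {m n : ℕ} (u ur : ℝ) (A : Matrix (Fin m) (Fin n) ℝ) (b : Fin m → ℝ)
    (R : Matrix (Fin n) (Fin n) ℝ) (x x' : Fin n → ℝ) : Prop :=
  ∃ (r : Fin m → ℝ) (h g y d : Fin n → ℝ),
    (∀ i, FlSubDot ur Finset.univ (b i) (A i) x (r i)) ∧
    (∀ j, FlDot ur Finset.univ (fun i => A i j) r (h j)) ∧
    (∀ j, Rounds u (h j) (g j)) ∧
    FlForwardSubst u Rᵀ g y ∧
    FlBackSubst u R y d ∧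
    ∀ j, Rounds u (x j + d j) (x' j)

/-- The quantity `2 + ‖r*‖₂ / (‖A‖₂ ‖x*‖₂)`, `r* = b - A x*`, in the limiting accuracy. -/
def residualFactor {m n : ℕ} (A : Matrix (Fin m) (Fin n) ℝ) (b : Fin m → ℝ)
    (xs : Fin n → ℝ) : ℝ :=
  2 + norm2 (b - A *ᵥ xs) / (‖A‖ * norm2 xs)

/-- Relative forward error of the approximation `x` to `xs`. -/
def relErr {n : ℕ} (xs x : Fin n → ℝ) : ℝ := norm2 (xs - x) / norm2 xs

end

/-! One refinement step is an approximate solve of `AᵀA e = Aᵀ(b - A x)`, whose exact solution is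
the current error `e = xs - x`, because `xs` satisfies the normal equations. The new error is
therefore `e - d`, up to the final rounding, where `d` is the computed correction; it is enough to
bound the effect of replacing `AᵀA` by the factors actually used and of the error in the right-hand
side.

Householder QR is backward stable: each computed step is an exact reflector plus a small columnwise
error, and orthogonal matrices carry these errors back to `A` without growth. Hence `RᵀR = (A +
E)ᵀ(A + E)` with `‖E‖ = O(u)‖A‖` (`FlHouseholderQR.exists_norm_backward_error`). The orthogonal
factor cancels in the Gram matrix, so it plays no further role. The two substitutions solve exactly
with matrices `Wᵀ` and `V` entrywise close to `Rᵀ` and `R`.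

Then `e - d = V⁻¹ W⁻ᵀ (WᵀV e - g)`. Invertibility is proved for `W` and `V` separately, by comparing
`‖W z‖` with `‖A z‖`; this costs only smallness of `u κ(A)`, whereas comparing `WᵀV` with `AᵀA`
directly would cost smallness of `u κ(A)²`. The inverses give `4‖A†‖²`, the perturbation of `AᵀA` is
`O(u)‖A‖²`, and their product is the contraction factor `O(u κ(A)²)`
(`norm2_sub_le_of_seminormal_solve`). Errors in forming the right-hand side are of order `ur`
(`exists_norm2_rhs_sub_le`); rounding it to precision `u` is a relative error in `AᵀA e`, so it only
enlarges the contraction factor.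

The second part divides by `‖xs‖`, absorbs the iterate norms into relative errors, and iterates `E ↦
E/2 + 2η`. -/

noncomputable section

/-! ### Relative error factors -/

/-- `t` is a product of at most `k` factors `1 + δ` or `1 / (1 + δ)` with `|δ| ≤ u`, up to the
bounds that this implies. -/
def RelFactor (u : ℝ) (k : ℕ) (t : ℝ) : Prop := (1 - u) ^ k ≤ t ∧ t * (1 - u) ^ k ≤ 1

namespace RelFactor

variable {u : ℝ} {k l : ℕ} {s t : ℝ}

theorem pos (hu : u < 1) (h : RelFactor u k t) : 0 < t :=
  lt_of_lt_of_le (pow_pos (by linarith) k) h.1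

theorem one (hu0 : 0 ≤ u) (hu : u < 1) (k : ℕ) : RelFactor u k 1 := by
  have : (1 - u) ^ k ≤ 1 := pow_le_one₀ (by linarith) (by linarith)
  exact ⟨this, by simpa using this⟩

theorem mono (hu0 : 0 ≤ u) (hu : u < 1) (h : RelFactor u k t) (hkl : k ≤ l) :
    RelFactor u l t := by
  have h1 : (1 - u) ^ l ≤ (1 - u) ^ k := pow_le_pow_of_le_one (by linarith) (by linarith) hkl
  exact ⟨h1.trans h.1, (mul_le_mul_of_nonneg_left h1 (h.pos hu).le).trans h.2⟩

theorem mul (hu : u < 1) (hs : RelFactor u k s) (ht : RelFactor u l t) :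
    RelFactor u (k + l) (s * t) := by
  have h0 : 0 < 1 - u := by linarith
  have hs0 := hs.pos hu
  have ht0 := ht.pos hu
  refine ⟨?_, ?_⟩
  · rw [pow_add]
    exact mul_le_mul hs.1 ht.1 (by positivity) hs0.le
  · calc s * t * (1 - u) ^ (k + l) = (s * (1 - u) ^ k) * (t * (1 - u) ^ l) := by
          rw [pow_add]; ring
      _ ≤ 1 := mul_le_one₀ hs.2 (by positivity) ht.2

theorem inv (hu : u < 1) (ht : RelFactor u k t) : RelFactor u k t⁻¹ := by
  have ht0 := ht.pos hu
  refine ⟨?_, ?_⟩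
  · rw [← one_div, le_div_iff₀ ht0, mul_comm]
    exact ht.2
  · rw [inv_mul_le_iff₀ ht0, mul_one]
    exact ht.1

/-- A root would halve the exponent; keeping `k` is enough here and avoids parity questions. -/
theorem sqrt (hu0 : 0 ≤ u) (hu : u < 1) (ht : RelFactor u k t) : RelFactor u k √t := by
  have h0 : 0 < (1 - u) ^ k := pow_pos (by linarith) k
  have h1 : (1 - u) ^ k ≤ 1 := pow_le_one₀ (by linarith) (by linarith)
  refine ⟨Real.le_sqrt_of_sq_le (by nlinarith [ht.1]), ?_⟩
  have h2 : √t ^ 2 = t := Real.sq_sqrt (ht.pos hu).le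
  have h3 := Real.sqrt_nonneg t
  have h4 := ht.2
  have : (√t * (1 - u) ^ k) ^ 2 ≤ 1 := by
    rw [mul_pow, h2]
    nlinarith [mul_le_mul_of_nonneg_left h1 (mul_pos (ht.pos hu) h0).le]
  exact (sq_le_one_iff₀ (by positivity)).1 this

/-- Bernoulli's inequality gives `t (1 - k u) ≤ 1`, hence `t ≤ 2` and then `t - 1 ≤ t k u ≤ 2 k u`.
This turns products of factors into linear bounds. -/
theorem abs_sub_one_le (hu0 : 0 ≤ u) (hu : u < 1) (hk : k * u ≤ 1 / 2) (ht : RelFactor u k t) :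
    |t - 1| ≤ 2 * k * u := by
  have hb : 1 - k * u ≤ (1 - u) ^ k := by
    have := one_add_mul_le_pow (a := -u) (by linarith) k
    calc 1 - k * u = 1 + k * -u := by ring
      _ ≤ (1 + -u) ^ k := this
      _ = (1 - u) ^ k := by ring
  have ht0 := ht.pos hu
  have hku : 0 ≤ k * u := by positivity
  rw [abs_le]
  refine ⟨by linarith [ht.1], ?_⟩
  have h2 : t * (1 - k * u) ≤ 1 := (mul_le_mul_of_nonneg_left hb ht0.le).trans ht.2
  have h3 : t ≤ 2 := by nlinarith
  nlinarith

/-- A weighted mean of factors, the weights being nonnegative, is a factor. -/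
theorem exists_sum_eq {ι : Type*} (hu0 : 0 ≤ u) (hu : u < 1) (S : Finset ι) {a t : ι → ℝ}
    (ha : ∀ i ∈ S, 0 ≤ a i) (ht : ∀ i ∈ S, RelFactor u k (t i)) :
    ∃ τ, RelFactor u k τ ∧ ∑ i ∈ S, a i * t i = (∑ i ∈ S, a i) * τ := by
  have h0 : 0 < (1 - u) ^ k := pow_pos (by linarith) k
  rcases (Finset.sum_nonneg ha).eq_or_lt with h | h
  · refine ⟨1, one hu0 hu k, ?_⟩
    rw [← h, zero_mul]
    have := (Finset.sum_eq_zero_iff_of_nonneg ha).1 h.symm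
    exact Finset.sum_eq_zero fun i hi => by rw [this i hi, zero_mul]
  · refine ⟨(∑ i ∈ S, a i * t i) / ∑ i ∈ S, a i, ⟨?_, ?_⟩, by field_simp⟩
    · rw [le_div_iff₀ h, mul_comm, Finset.sum_mul]
      exact Finset.sum_le_sum fun i hi => mul_le_mul_of_nonneg_left (ht i hi).1 (ha i hi)
    · rw [div_mul_eq_mul_div, div_le_one h, Finset.sum_mul]
      refine Finset.sum_le_sum fun i hi => ?_
      rw [mul_assoc]
      exact mul_le_of_le_one_right (ha i hi) (ht i hi).2

/-- Terms of equal sign do not cancel, so a relative error in one of them stays relative to the sum.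
The sign chosen for `s` in a Householder reflector makes this apply to `x p + s`. -/
theorem exists_add_eq {a b : ℝ} (hu0 : 0 ≤ u) (hu : u < 1) (hab : 0 ≤ a * b)
    (ht : RelFactor u k t) :
    ∃ τ, RelFactor u k τ ∧ a + b * t = (a + b) * τ := by
  have key : ∀ a b : ℝ, 0 ≤ a → 0 ≤ b → ∃ τ, RelFactor u k τ ∧ a + b * t = (a + b) * τ := by
    intro a b ha hb
    obtain ⟨τ, hτ, h⟩ := exists_sum_eq (k := k) hu0 hu Finset.univ (a := ![a, b]) (t := ![1, t])
      (by simp [Fin.forall_fin_two, ha, hb]) (by simp [Fin.forall_fin_two, ht, one hu0 hu k])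
    exact ⟨τ, hτ, by simpa using h⟩
  rcases mul_nonneg_iff.1 hab with ⟨ha, hb⟩ | ⟨ha, hb⟩
  · exact key a b ha hb
  · obtain ⟨τ, hτ, h⟩ := key (-a) (-b) (by linarith) (by linarith)
    exact ⟨τ, hτ, by linarith⟩

end RelFactor

/-! ### Computed sums, inner products and norms -/

/-- The two forms of the standard model supply the two sides of `RelFactor`: `δ` bounds the factor
below, `ε` bounds it above. -/
theorem Rounds.exists_factor {u x z : ℝ} (hu0 : 0 ≤ u) (hu : u < 1) (h : Rounds u x z) :
    ∃ t, RelFactor u 1 t ∧ z = x * t := by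
  rcases eq_or_ne x 0 with rfl | hx
  · refine ⟨1, RelFactor.one hu0 hu 1, ?_⟩
    simpa using h.1
  · refine ⟨z / x, ?_, by field_simp⟩
    have h1 : |z / x - 1| ≤ u := by
      rw [div_sub_one hx, abs_div, div_le_iff₀ (abs_pos.2 hx)]
      exact h.1
    have h2 : |z / x - 1| ≤ u * |z / x| := by
      rw [div_sub_one hx, abs_div, abs_div, ← mul_div_assoc]
      exact div_le_div_of_nonneg_right h.2 (abs_nonneg x)
    have h3 : 0 < z / x := by linarith [(abs_le.1 h1).1]
    rw [abs_of_pos h3] at h2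
    have := abs_le.1 h1
    have := abs_le.1 h2
    constructor
    · rw [pow_one]; linarith
    · rw [pow_one]; linarith

theorem FlSum.exists_factor {ι : Type*} [DecidableEq ι] {u : ℝ} (hu0 : 0 ≤ u) (hu : u < 1)
    {f : ι → ℝ} {S : Finset ι} {z : ℝ} (h : FlSum u f S z) :
    ∃ t : ι → ℝ, (∀ i, RelFactor u S.card (t i)) ∧ z = ∑ i ∈ S, f i * t i := by
  induction h with
  | empty => exact ⟨1, fun i => RelFactor.one hu0 hu _, by simp⟩
  | single i => exact ⟨1, fun i => RelFactor.one hu0 hu _, by simp⟩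
  | @add S T s t z hS hT hST _ _ hz ihs iht =>
    obtain ⟨a, ha, rfl⟩ := ihs
    obtain ⟨b, hb, rfl⟩ := iht
    obtain ⟨τ, hτ, rfl⟩ := hz.exists_factor hu0 hu
    have hcard := Finset.card_union_of_disjoint hST
    have hS1 := hS.card_pos
    have hT1 := hT.card_pos
    -- A leaf of either subtree receives one more rounding; the other subtree, being nonempty,
    -- raises the cardinality by at least one to pay for it. The bound thus holds for every order of
    -- summation.
    refine ⟨fun i => (if i ∈ S then a i else b i) * τ, fun i => ?_, ?_⟩
    · by_cases hi : i ∈ S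
      · simpa [hi] using ((ha i).mul hu hτ).mono hu0 hu (by omega)
      · simpa [hi] using ((hb i).mul hu hτ).mono hu0 hu (by omega)
    · rw [Finset.sum_union hST, add_mul, Finset.sum_mul, Finset.sum_mul]
      congr 1
      · exact Finset.sum_congr rfl fun i hi => by simp [hi, mul_assoc]
      · refine Finset.sum_congr rfl fun i hi => ?_
        have : i ∉ S := fun h => Finset.disjoint_left.1 hST h hi
        simp [this, mul_assoc]

theorem FlDot.exists_factor {ι : Type*} [DecidableEq ι] {u : ℝ} (hu0 : 0 ≤ u) (hu : u < 1)
    {S : Finset ι} {a y : ι → ℝ} {z : ℝ} (h : FlDot u S a y z) :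
    ∃ t : ι → ℝ, (∀ i ∈ S, RelFactor u (S.card + 1) (t i)) ∧ z = ∑ i ∈ S, a i * y i * t i := by
  obtain ⟨p, hp, hz⟩ := h
  obtain ⟨t, ht, rfl⟩ := hz.exists_factor hu0 hu
  have hp' := fun j (hj : j ∈ S) => (hp j hj).exists_factor hu0 hu
  choose! s hs hps using hp'
  refine ⟨fun i => t i * s i, fun i hi => (ht i).mul hu (hs i hi), ?_⟩
  refine Finset.sum_congr rfl fun i hi => ?_
  rw [hps i hi]; ring

theorem FlSubDot.exists_factor {ι : Type*} [DecidableEq ι] {u : ℝ} (hu0 : 0 ≤ u) (hu : u < 1)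
    {S : Finset ι} {c : ℝ} {a y : ι → ℝ} {z : ℝ} (h : FlSubDot u S c a y z) :
    ∃ (τ : ℝ) (t : ι → ℝ), RelFactor u (S.card + 2) τ ∧
      (∀ i ∈ S, RelFactor u (S.card + 2) (t i)) ∧ z = c * τ - ∑ i ∈ S, a i * y i * t i := by
  obtain ⟨p, hp, hz⟩ := h
  obtain ⟨t, ht, rfl⟩ := hz.exists_factor hu0 hu
  have hp' := fun j (hj : j ∈ S) => (hp j hj).exists_factor hu0 hu
  choose! s hs hps using hp'
  rw [Finset.card_insertNone] at ht
  refine ⟨t none, fun i => t (some i) * s i, (ht _).mono hu0 hu (by omega),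
    fun i hi => ((ht _).mul hu (hs i hi)).mono hu0 hu (by omega), ?_⟩
  rw [Finset.sum_insertNone, sub_eq_add_neg, ← Finset.sum_neg_distrib]
  congr 1
  refine Finset.sum_congr rfl fun i hi => ?_
  simp only [Option.elim]
  rw [hps i hi]; ring

/-- The summands are squares, so their separate factors average to one factor that can be pulled out
of the root. -/
theorem FlNorm.exists_factor {ι : Type*} [DecidableEq ι] {u : ℝ} (hu0 : 0 ≤ u) (hu : u < 1)
    {S : Finset ι} {x : ι → ℝ} {ρ : ℝ} (h : FlNorm u S x ρ) :
    ∃ t : ℝ, RelFactor u (S.card + 2) t ∧ ρ = √(∑ i ∈ S, x i ^ 2) * t := by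
  obtain ⟨q, hq, hρ⟩ := h
  obtain ⟨t, ht, rfl⟩ := hq.exists_factor hu0 hu
  obtain ⟨τ, hτ, h⟩ := RelFactor.exists_sum_eq hu0 hu S (a := fun i => x i * x i)
    (fun i _ => mul_self_nonneg _) ht
  obtain ⟨σ, hσ, rfl⟩ := hρ.exists_factor hu0 hu
  refine ⟨√τ * σ, ((hτ.sqrt hu0 hu).mul hu hσ).mono hu0 hu (by omega), ?_⟩
  rw [h, Real.sqrt_mul (Finset.sum_nonneg fun i _ => mul_self_nonneg _)]
  simp only [pow_two, mul_assoc]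

/-! ### Euclidean and spectral norms -/

section Norms

variable {ι κ : Type*} [Fintype ι] [Fintype κ]

theorem norm2_nonneg (v : ι → ℝ) : 0 ≤ norm2 v := norm_nonneg _

theorem norm2_sq (v : ι → ℝ) : norm2 v ^ 2 = ∑ i, v i ^ 2 := by
  rw [norm2, EuclideanSpace.real_norm_sq_eq]

theorem norm2_sq_eq_dotProduct (v : ι → ℝ) : norm2 v ^ 2 = v ⬝ᵥ v := by
  rw [norm2_sq]
  simp only [dotProduct, pow_two]

theorem norm2_add_le (v w : ι → ℝ) : norm2 (v + w) ≤ norm2 v + norm2 w := norm_add_le _ _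

theorem norm2_sub_le (v w : ι → ℝ) : norm2 (v - w) ≤ norm2 v + norm2 w := norm_sub_le _ _

theorem norm2_sub_rev (v w : ι → ℝ) : norm2 (v - w) = norm2 (w - v) := norm_sub_rev _ _

theorem norm2_zero : norm2 (0 : ι → ℝ) = 0 := by simp [norm2]

theorem norm2_eq_zero {v : ι → ℝ} : norm2 v = 0 ↔ v = 0 := by
  simp [norm2]

theorem abs_le_norm2 (v : ι → ℝ) (i : ι) : |v i| ≤ norm2 v := by
  refine abs_le_of_sq_le_sq ?_ (norm2_nonneg v)
  rw [norm2_sq]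
  exact Finset.single_le_sum (f := fun i => v i ^ 2) (fun i _ => sq_nonneg _) (Finset.mem_univ i)

theorem norm2_le_sum (v : ι → ℝ) : norm2 v ≤ ∑ i, |v i| := by
  refine le_of_sq_le_sq ?_ (Finset.sum_nonneg fun i _ => abs_nonneg _)
  rw [norm2_sq]
  calc ∑ i, v i ^ 2 = ∑ i, |v i| ^ 2 := by simp only [sq_abs]
    _ ≤ (∑ i, |v i|) ^ 2 := Finset.sum_sq_le_sq_sum_of_nonneg fun i _ => abs_nonneg _

theorem norm2_le_card_mul {v : ι → ℝ} {a : ℝ} (h : ∀ i, |v i| ≤ a) :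
    norm2 v ≤ Fintype.card ι * a :=
  (norm2_le_sum v).trans <| (Finset.sum_le_sum fun i _ => h i).trans_eq (by simp)

theorem norm2_mulVec_le [DecidableEq κ] (M : Matrix ι κ ℝ) (v : κ → ℝ) :
    norm2 (M *ᵥ v) ≤ ‖M‖ * norm2 v :=
  Matrix.l2_opNorm_mulVec M (WithLp.toLp 2 v)

theorem l2_opNorm_le_of_forall [DecidableEq κ] {M : Matrix ι κ ℝ} {a : ℝ} (ha : 0 ≤ a)
    (h : ∀ v, norm2 (M *ᵥ v) ≤ a * norm2 v) : ‖M‖ ≤ a := by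
  rw [Matrix.l2_opNorm_def]
  exact ContinuousLinearMap.opNorm_le_bound _ ha fun v => h v.ofLp

theorem norm2_col_le [DecidableEq κ] (M : Matrix ι κ ℝ) (j : κ) :
    norm2 (fun i => M i j) ≤ ‖M‖ := by
  have h := norm2_mulVec_le M (Pi.single j 1)
  have h1 : norm2 (Pi.single j (1 : ℝ)) = 1 := by
    have := norm2_sq (Pi.single j (1 : ℝ))
    simp [Pi.single_apply] at this
    rcases this with h | h
    · exact h
    · linarith [norm2_nonneg (Pi.single j (1 : ℝ))]
  rw [h1, mul_one, Matrix.mulVec_single_one] at h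
  exact h

theorem abs_entry_le [DecidableEq κ] (M : Matrix ι κ ℝ) (i : ι) (j : κ) : |M i j| ≤ ‖M‖ :=
  (abs_le_norm2 (fun i => M i j) i).trans (norm2_col_le M j)

theorem l2_opNorm_le_of_norm2_col_le [DecidableEq κ] {M : Matrix ι κ ℝ} {a : ℝ} (ha : 0 ≤ a)
    (h : ∀ j, norm2 (fun i => M i j) ≤ a) : ‖M‖ ≤ Fintype.card κ * a := by
  refine l2_opNorm_le_of_forall (by positivity) fun v => ?_
  have h1 : WithLp.toLp 2 (M *ᵥ v) = ∑ j, v j • WithLp.toLp 2 (fun i => M i j) := by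
    ext i
    simp [Matrix.mulVec, dotProduct, mul_comm]
  rw [norm2, h1]
  refine (norm_sum_le _ _).trans ?_
  calc ∑ j, ‖v j • WithLp.toLp 2 (fun i => M i j)‖ ≤ ∑ _j : κ, norm2 v * a := by
        refine Finset.sum_le_sum fun j _ => ?_
        rw [norm_smul]
        exact mul_le_mul (abs_le_norm2 v j) (h j) (norm_nonneg _) (norm2_nonneg v)
    _ = _ := by simp; ring

theorem l2_opNorm_le_of_abs_entry_le [DecidableEq κ] {M : Matrix ι κ ℝ} {a : ℝ} (ha : 0 ≤ a)
    (h : ∀ i j, |M i j| ≤ a) : ‖M‖ ≤ Fintype.card κ * (Fintype.card ι * a) :=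
  l2_opNorm_le_of_norm2_col_le (by positivity) fun j => norm2_le_card_mul fun i => h i j

theorem l2_opNorm_transpose [DecidableEq ι] [DecidableEq κ] (M : Matrix ι κ ℝ) :
    ‖Mᵀ‖ = ‖M‖ := by
  rw [← Matrix.conjTranspose_eq_transpose_of_trivial, Matrix.l2_opNorm_conjTranspose]

theorem l2_opNorm_transpose_mul_self [DecidableEq ι] [DecidableEq κ] (M : Matrix ι κ ℝ) :
    ‖Mᵀ * M‖ = ‖M‖ * ‖M‖ := by
  rw [← Matrix.conjTranspose_eq_transpose_of_trivial, Matrix.l2_opNorm_conjTranspose_mul_self]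

theorem norm2_mulVec_of_transpose_mul_self_eq_one [DecidableEq κ] {Q : Matrix ι κ ℝ}
    (hQ : Qᵀ * Q = 1) (v : κ → ℝ) : norm2 (Q *ᵥ v) = norm2 v := by
  have h : norm2 (Q *ᵥ v) ^ 2 = norm2 v ^ 2 := by
    rw [norm2_sq_eq_dotProduct, norm2_sq_eq_dotProduct, Matrix.dotProduct_mulVec,
      ← Matrix.mulVec_transpose, Matrix.mulVec_mulVec, hQ, Matrix.one_mulVec]
  exact (sq_eq_sq₀ (norm2_nonneg _) (norm2_nonneg _)).1 h

theorem sum_abs_mul_abs_le (v w : ι → ℝ) : ∑ i, |v i| * |w i| ≤ norm2 v * norm2 w := by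
  refine le_of_sq_le_sq ?_ (mul_nonneg (norm2_nonneg _) (norm2_nonneg _))
  have h := Finset.sum_mul_sq_le_sq_mul_sq Finset.univ (fun i => |v i|) (fun i => |w i|)
  simp only [sq_abs] at h
  rwa [mul_pow, norm2_sq, norm2_sq]

end Norms

/-! ### Householder reflectors -/

/-- The matrix `I - β v vᵀ`. -/
def reflectorMatrix {m : ℕ} (v : Fin m → ℝ) (β : ℝ) : Matrix (Fin m) (Fin m) ℝ :=
  1 - β • Matrix.vecMulVec v v

theorem reflectorMatrix_mulVec {m : ℕ} (v : Fin m → ℝ) (β : ℝ) (y : Fin m → ℝ) (i : Fin m) :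
    (reflectorMatrix v β *ᵥ y) i = y i - β * (∑ j, v j * y j) * v i := by
  rw [reflectorMatrix, Matrix.sub_mulVec, Matrix.one_mulVec, Matrix.smul_mulVec,
    Matrix.vecMulVec_mulVec]
  simp [dotProduct]
  ring

theorem reflectorMatrix_transpose_mul_self {m : ℕ} {v : Fin m → ℝ} {β : ℝ}
    (h : β * ∑ i, v i ^ 2 = 2 ∨ v = 0) :
    (reflectorMatrix v β)ᵀ * reflectorMatrix v β = 1 := by
  rcases h with h | rfl
  · have h1 : v ⬝ᵥ v = ∑ i, v i ^ 2 := by simp only [dotProduct, pow_two]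
    have h2 : Matrix.vecMulVec v v * Matrix.vecMulVec v v
        = (∑ i, v i ^ 2) • Matrix.vecMulVec v v := by
      rw [Matrix.vecMulVec_mul_vecMulVec, h1]
      ext i j
      simp [Matrix.vecMulVec_apply]
      ring
    rw [reflectorMatrix, Matrix.transpose_sub, Matrix.transpose_one, Matrix.transpose_smul,
      Matrix.transpose_vecMulVec, Matrix.sub_mul, Matrix.mul_sub, Matrix.mul_sub, Matrix.one_mul,
      Matrix.mul_one, Matrix.one_mul, Matrix.smul_mul, Matrix.mul_smul, h2]
    rw [smul_smul β (∑ i, v i ^ 2), h, smul_smul, mul_comm β 2, mul_smul, two_smul]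
    abel
  · simp [reflectorMatrix]

theorem Finset.sum_Ici_eq_add_sum_Ioi {m : ℕ} (p : Fin m) (f : Fin m → ℝ) :
    ∑ i ∈ Finset.Ici p, f i = f p + ∑ i ∈ Finset.Ioi p, f i := by
  rw [← Finset.Ioi_insert, Finset.sum_insert (by simp)]

theorem Finset.sum_univ_eq_sum_Ici {m : ℕ} (p : Fin m) {f : Fin m → ℝ}
    (h : ∀ i, i < p → f i = 0) : ∑ i, f i = ∑ i ∈ Finset.Ici p, f i := by
  symm
  refine Finset.sum_subset (Finset.subset_univ _) fun i _ hi => h i ?_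
  simpa using hi

/-- The computed data of a reflector are entrywise close to those of an exact reflector that
annihilates the same vector. -/
theorem FlReflector.exists_exact {m : ℕ} {u : ℝ} (hu0 : 0 ≤ u) (hu : u < 1) {p : Fin m}
    {x v : Fin m → ℝ} {s β : ℝ} (h : FlReflector u p x v s β) :
    ∃ (w : Fin m → ℝ) (σ γ : ℝ), (∀ i, i < p → w i = 0) ∧ 0 ≤ γ ∧
      (γ * ∑ i, w i ^ 2 = 2 ∨ w = 0) ∧ |σ| ≤ norm2 x ∧
      x p - γ * (∑ j, w j * x j) * w p = -σ ∧
      (∀ i, p < i → x i - γ * (∑ j, w j * x j) * w i = 0) ∧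
      (∃ t, RelFactor u (m + 2) t ∧ s = σ * t) ∧
      (∀ i, ∃ t, RelFactor u (m + 3) t ∧ v i = w i * t) ∧
      (∃ t, RelFactor u (2 * m + 7) t ∧ β = γ * t) := by
  rw [FlReflector] at h
  by_cases h0 : ∀ i, p ≤ i → x i = 0
  · rw [if_pos h0] at h
    obtain ⟨rfl, rfl, rfl⟩ := h
    refine ⟨0, 0, 0, by simp, le_rfl, Or.inr rfl, by simpa using norm2_nonneg x,
      by simpa using h0 p le_rfl, fun i hi => by simpa using h0 i hi.le,
      ⟨1, RelFactor.one hu0 hu _, by simp⟩, fun i => ⟨1, RelFactor.one hu0 hu _, by simp⟩,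
      ⟨1, RelFactor.one hu0 hu _, by simp⟩⟩
  rw [if_neg h0] at h
  obtain ⟨⟨ρ, hρ, hs⟩, hvlt, hvp, hvgt, d, hd, hβ⟩ := h
  obtain ⟨a, ha, rfl⟩ := hρ.exists_factor hu0 hu
  have hcard : (Finset.Ici p).card ≤ m := (Finset.card_le_univ _).trans_eq (by simp)
  replace ha := ha.mono hu0 hu (show _ ≤ m + 2 by omega)
  set T := ∑ i ∈ Finset.Ici p, x i ^ 2 with hT
  have hTpos : 0 < T := by
    push Not at h0
    obtain ⟨i, hi, hxi⟩ := h0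
    exact Finset.sum_pos' (fun i _ => sq_nonneg _) ⟨i, by simpa using hi, by positivity⟩
  -- The exact reflector has `w = x + σ e_p` on the trailing part and `γ = 1 / (σ (x p + σ))`. Both
  -- `wᵀx` and `wᵀw / 2` equal `σ (x p + σ)`, so `γ wᵀx = 1` and the image of `x` there is `x - w =
  -- -σ e_p`.
  set σ : ℝ := if 0 ≤ x p then √T else -√T with hσ
  have hsq : √T ^ 2 = T := Real.sq_sqrt hTpos.le
  have hsqrt : 0 < √T := Real.sqrt_pos.2 hTpos
  have hσ2 : σ ^ 2 = T := by
    rw [hσ]; split_ifs <;> simp [hsq]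
  have hxσ : 0 ≤ x p * σ := by
    rw [hσ]; split_ifs with h
    · positivity
    · push Not at h; nlinarith
  have hsσ : s = σ * a := by
    rw [hs, hσ]; split_ifs <;> ring
  have hσ0 : σ ≠ 0 := by
    rintro h
    rw [h] at hσ2
    linarith
  have hden : 0 < σ * (x p + σ) := by nlinarith
  have hsplit := Finset.sum_Ici_eq_add_sum_Ioi p (fun i => x i ^ 2)
  rw [← hT] at hsplit
  set D := ∑ i ∈ Finset.Ioi p, x i ^ 2 with hD
  let w : Fin m → ℝ := fun i => if i < p then 0 else if i = p then x p + σ else x i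
  have hwlt : ∀ i, i < p → w i = 0 := fun i hi => by simp [w, hi]
  have hwp : w p = x p + σ := by simp [w]
  have hwgt : ∀ i, p < i → w i = x i := fun i hi => by simp [w, hi.not_gt, hi.ne']
  have hww : ∑ i, w i ^ 2 = 2 * (σ * (x p + σ)) := by
    rw [Finset.sum_univ_eq_sum_Ici p (fun i hi => by simp [hwlt i hi]),
      Finset.sum_Ici_eq_add_sum_Ioi, hwp,
      Finset.sum_congr rfl (fun i hi => by rw [hwgt i (by simpa using hi)] :
        ∀ i ∈ Finset.Ioi p, w i ^ 2 = x i ^ 2), ← hD]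
    linear_combination -hsplit - hσ2
  have hwx : ∑ i, w i * x i = σ * (x p + σ) := by
    rw [Finset.sum_univ_eq_sum_Ici p (fun i hi => by simp [hwlt i hi]),
      Finset.sum_Ici_eq_add_sum_Ioi, hwp,
      Finset.sum_congr rfl (fun i hi => by rw [hwgt i (by simpa using hi), pow_two] :
        ∀ i ∈ Finset.Ioi p, w i * x i = x i ^ 2), ← hD]
    linear_combination -hsplit - hσ2
  have hγx : 1 / (σ * (x p + σ)) * ∑ i, w i * x i = 1 := by
    rw [hwx]; exact one_div_mul_cancel hden.ne'
  obtain ⟨b, hb, hvb⟩ := hvp.exists_factor hu0 hu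
  obtain ⟨b', hb', hbb'⟩ := RelFactor.exists_add_eq (a := x p) (b := σ) hu0 hu hxσ ha
  obtain ⟨e, he, hde⟩ := hd.exists_factor hu0 hu
  obtain ⟨f, hf, hβf⟩ := hβ.exists_factor hu0 hu
  have hvw : v p = w p * (b' * b) := by
    rw [hvb, hsσ, hbb', hwp, mul_assoc]
  refine ⟨w, σ, 1 / (σ * (x p + σ)), hwlt, by positivity, Or.inl ?_, ?_, ?_, ?_, ⟨a, ha, hsσ⟩,
    fun i => ?_, (a * (b' * b) * e)⁻¹ * f, ?_, ?_⟩
  · rw [hww, one_div, mul_left_comm, inv_mul_cancel₀ hden.ne', mul_one]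
  · refine abs_le_of_sq_le_sq ?_ (norm2_nonneg x)
    rw [hσ2, norm2_sq, hT]
    exact Finset.sum_le_sum_of_subset_of_nonneg (Finset.subset_univ _) fun i _ _ => sq_nonneg _
  · rw [hγx, hwp]; ring
  · intro i hi
    rw [hγx, hwgt i hi]; ring
  · rcases lt_trichotomy i p with hi | rfl | hi
    · exact ⟨1, RelFactor.one hu0 hu _, by rw [hvlt i hi, hwlt i hi, zero_mul]⟩
    · exact ⟨b' * b, (hb'.mul hu hb).mono hu0 hu (by omega), hvw⟩
    · exact ⟨1, RelFactor.one hu0 hu _, by rw [hvgt i hi, hwgt i hi, mul_one]⟩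
  -- The count for `β` is `m + 2` from `s`, `m + 3` from `v p`, and one each from the product and
  -- the reciprocal.
  · exact ((((ha.mul hu (hb'.mul hu hb)).mul hu he).inv hu).mul hu hf).mono hu0 hu (by omega)
  · rw [hβf, hde, hsσ, hvw, hwp, one_div, one_div]
    simp only [mul_inv]
    ring

/-! ### Backward error of Householder QR factorization -/

/-- The column update `y - (β (vᵀ y)) v`, computed with approximate reflector data. -/
theorem abs_reflector_update_sub_le {m : ℕ} {u : ℝ} (hu0 : 0 ≤ u) (hu : u < 1)
    (hmu : (5 * m + 17 : ℕ) * u ≤ 1 / 2) {p i : Fin m} {v w y : Fin m → ℝ} {β γ a t g z : ℝ}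
    (hw : ∀ i, i < p → w i = 0) (hγ : 0 ≤ γ) (hγw : γ * ∑ i, w i ^ 2 = 2 ∨ w = 0)
    (hv : ∀ i, ∃ t, RelFactor u (m + 3) t ∧ v i = w i * t)
    (hβ : ∃ t, RelFactor u (2 * m + 7) t ∧ β = γ * t)
    (ha : FlDot u (Finset.Ici p) v y a) (ht : Rounds u (β * a) t) (hg : Rounds u (t * v i) g)
    (hz : Rounds u (y i - g) z) :
    |z - (reflectorMatrix w γ *ᵥ y) i| ≤ 3 * (2 * (5 * m + 17 : ℕ) * u) * norm2 y := by
  set ε := 2 * (5 * m + 17 : ℕ) * u with hε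
  have hε0 : 0 ≤ ε := by positivity
  have hcard : (Finset.Ici p).card ≤ m := (Finset.card_le_univ _).trans_eq (by simp)
  choose s hs hvs using hv
  obtain ⟨b, hb, rfl⟩ := hβ
  obtain ⟨c, hc, rfl⟩ := ha.exists_factor hu0 hu
  obtain ⟨d, hd, rfl⟩ := ht.exists_factor hu0 hu
  obtain ⟨e, he, rfl⟩ := hg.exists_factor hu0 hu
  obtain ⟨f, hf, rfl⟩ := hz.exists_factor hu0 hu
  have hf' : |f - 1| ≤ ε := (hf.mono hu0 hu (by omega)).abs_sub_one_le hu0 hu hmu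
  have hF : ∀ j ∈ Finset.Ici p, |s j * c j * b * d * s i * e * f - 1| ≤ ε := by
    intro j hj
    -- The exponents are `m + 3` for each of `v j` and `v i`, `m + 1` for the inner product, `2 m +
    -- 7` for `β`, and three single roundings.
    refine RelFactor.abs_sub_one_le (k := 5 * m + 17) hu0 hu hmu ?_
    exact (((((((hs j).mul hu (hc j hj)).mul hu hb).mul hu hd).mul hu (hs i)).mul hu he).mul hu
      hf).mono hu0 hu (by omega)
  have hsum : ∑ j, w j * y j = ∑ j ∈ Finset.Ici p, w j * y j :=
    Finset.sum_univ_eq_sum_Ici p fun i hi => by rw [hw i hi, zero_mul]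
  have hγw2 : γ * norm2 w ^ 2 ≤ 2 := by
    rcases hγw with h | rfl
    · rw [norm2_sq, h]
    · simp [norm2_zero]
  -- All roundings met by the `j`-th product are collected in one factor. The first term contributes
  -- `ε ‖y‖`, the second `2 ε ‖y‖` because `γ ‖w‖² ≤ 2`; this is the constant 3.
  have key : (y i - γ * b * (∑ j ∈ Finset.Ici p, v j * y j * c j) * d * v i * e) * f
      - (reflectorMatrix w γ *ᵥ y) i = y i * (f - 1)
        - γ * w i * ∑ j ∈ Finset.Ici p, w j * y j * (s j * c j * b * d * s i * e * f - 1) := by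
    rw [reflectorMatrix_mulVec, hsum]
    simp only [mul_sub, Finset.sum_sub_distrib, mul_one]
    have h1 : ∑ j ∈ Finset.Ici p, w j * y j * (s j * c j * b * d * s i * e * f)
        = (∑ j ∈ Finset.Ici p, v j * y j * c j) * (b * d * s i * e * f) := by
      rw [Finset.sum_mul]
      refine Finset.sum_congr rfl fun j _ => ?_
      rw [hvs j]; ring
    rw [h1, hvs i]
    ring
  have h2 : |∑ j ∈ Finset.Ici p, w j * y j * (s j * c j * b * d * s i * e * f - 1)|
      ≤ norm2 w * norm2 y * ε := by
    calc _ ≤ ∑ j ∈ Finset.Ici p, |w j| * |y j| * ε := by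
          refine (Finset.abs_sum_le_sum_abs _ _).trans (Finset.sum_le_sum fun j hj => ?_)
          rw [abs_mul, abs_mul]
          exact mul_le_mul_of_nonneg_left (hF j hj) (by positivity)
      _ ≤ ∑ j, |w j| * |y j| * ε :=
          Finset.sum_le_sum_of_subset_of_nonneg (Finset.subset_univ _) fun _ _ _ => by positivity
      _ ≤ _ := by
          rw [← Finset.sum_mul]
          exact mul_le_mul_of_nonneg_right (sum_abs_mul_abs_le w y) hε0
  rw [key]
  refine (abs_sub _ _).trans ?_
  have h3 : |y i * (f - 1)| ≤ norm2 y * ε := by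
    rw [abs_mul]
    exact mul_le_mul (abs_le_norm2 y i) hf' (abs_nonneg _) (norm2_nonneg y)
  have h4 : |γ * w i * ∑ j ∈ Finset.Ici p, w j * y j * (s j * c j * b * d * s i * e * f - 1)|
      ≤ γ * norm2 w * (norm2 w * norm2 y * ε) := by
    rw [abs_mul, abs_mul, abs_of_nonneg hγ]
    have := norm2_nonneg w
    exact mul_le_mul (mul_le_mul_of_nonneg_left (abs_le_norm2 w i) hγ) h2 (abs_nonneg _)
      (by positivity)
  have h5 : γ * norm2 w * (norm2 w * norm2 y * ε) ≤ 2 * (norm2 y * ε) := by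
    have := mul_le_mul_of_nonneg_right hγw2 (mul_nonneg (norm2_nonneg y) hε0)
    linarith
  linarith

/-- One computed step is an exact orthogonal transformation up to small columnwise errors. -/
theorem FlHouseholderStep.exists_orthogonal {m n : ℕ} {u : ℝ} (hu0 : 0 ≤ u) (hu : u < 1)
    (hmu : (5 * m + 17 : ℕ) * u ≤ 1 / 2) {p : Fin m} {q : Fin n} {B B' : Matrix (Fin m) (Fin n) ℝ}
    (h : FlHouseholderStep u p q B B') (hB : ∀ i j, j < q → p ≤ i → B i j = 0) :
    ∃ P : Matrix (Fin m) (Fin m) ℝ, Pᵀ * P = 1 ∧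
      ∀ j, norm2 (fun i => (B' - P * B) i j) ≤
        m * (3 * (2 * (5 * m + 17 : ℕ) * u)) * norm2 (fun i => B i j) := by
  obtain ⟨v, s, β, hr, hkeep, hpq, hbelow, hup⟩ := h
  obtain ⟨w, σ, γ, hw, hγ, hγw, hσ, hxp, hxi, ⟨a, ha, hsa⟩, hv, hβ⟩ := hr.exists_exact hu0 hu
  refine ⟨reflectorMatrix w γ, reflectorMatrix_transpose_mul_self hγw, fun j => ?_⟩
  have hε0 : 0 ≤ 3 * (2 * (5 * m + 17 : ℕ) * u) := by positivity
  set ε := 3 * (2 * (5 * m + 17 : ℕ) * u) with hε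
  have hnn := norm2_nonneg (fun i => B i j)
  have : ∀ i, |(B' - reflectorMatrix w γ * B) i j| ≤ ε * norm2 (fun i => B i j) := by
    intro i
    have hPB : (reflectorMatrix w γ * B) i j = (reflectorMatrix w γ *ᵥ fun i => B i j) i := rfl
    rw [Matrix.sub_apply, hPB]
    have hzero : B' i j = (reflectorMatrix w γ *ᵥ fun i => B i j) i →
        |B' i j - (reflectorMatrix w γ *ᵥ fun i => B i j) i| ≤ ε * norm2 (fun i => B i j) := by
      intro h
      rw [h, sub_self, abs_zero]
      positivity
    by_cases hi : i < p
    · apply hzero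
      rw [hkeep i j (Or.inl hi), reflectorMatrix_mulVec, hw i hi]
      ring
    push Not at hi
    rcases lt_trichotomy j q with hj | rfl | hj
    -- Earlier columns vanish on the support of `w`, so the exact reflector fixes them, just as the
    -- algorithm leaves them untouched.
    · apply hzero
      rw [hkeep i j (Or.inr hj), reflectorMatrix_mulVec, Finset.sum_eq_zero]
      · ring
      · intro l _
        rcases lt_or_ge l p with hl | hl
        · rw [hw l hl, zero_mul]
        · rw [hB l j hj hl, mul_zero]
    · rcases hi.eq_or_lt with rfl | hi
      · rw [hpq, reflectorMatrix_mulVec, hxp, hsa]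
        have h1 : |a - 1| ≤ ε := by
          have := (ha.mono hu0 hu (show m + 2 ≤ 5 * m + 17 by omega)).abs_sub_one_le hu0 hu hmu
          linarith [abs_nonneg (a - 1)]
        calc |-(σ * a) - -σ| = |a - 1| * |σ| := by rw [← abs_mul, ← abs_neg]; congr 1; ring
          _ ≤ _ := mul_le_mul h1 hσ (abs_nonneg _) hε0
      · apply hzero
        rw [hbelow i hi, reflectorMatrix_mulVec, hxi i hi]
    · obtain ⟨a, t, hat, ht, hcol⟩ := hup j hj
      obtain ⟨g, hg, hz⟩ := hcol i hi
      exact abs_reflector_update_sub_le hu0 hu hmu hw hγ hγw hv hβ hat ht hg hz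
  refine (norm2_le_card_mul this).trans_eq ?_
  rw [Fintype.card_fin, ← mul_assoc]

theorem norm2_col_mul_of_transpose_mul_self_eq_one {m n : ℕ} {Q : Matrix (Fin m) (Fin m) ℝ}
    (hQ : Qᵀ * Q = 1) (M : Matrix (Fin m) (Fin n) ℝ) (j : Fin n) :
    norm2 (fun i => (Q * M) i j) = norm2 (fun i => M i j) :=
  norm2_mulVec_of_transpose_mul_self_eq_one hQ fun i => M i j

/-- Columnwise backward error of Householder QR factorization: the computed triangular factor is
an exact triangular factor of a nearby matrix. -/
theorem FlHouseholderQR.exists_backward_error {m n : ℕ} {hmn : n ≤ m} {u : ℝ} (hu0 : 0 ≤ u)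
    (hu : u < 1) (hmu : (5 * m + 17 : ℕ) * u ≤ 1 / 2) {A : Matrix (Fin m) (Fin n) ℝ}
    {R : Matrix (Fin n) (Fin n) ℝ} (h : FlHouseholderQR hmn u A R) :
    (∀ i j, j < i → R i j = 0) ∧ ∃ E : Matrix (Fin m) (Fin n) ℝ,
      Rᵀ * R = (A + E)ᵀ * (A + E) ∧
      ∀ j, norm2 (fun i => E i j) ≤
        ((1 + m * (3 * (2 * (5 * m + 17 : ℕ) * u))) ^ n - 1) * norm2 (fun i => A i j) := by
  obtain ⟨B, hB0, hstep, hR⟩ := h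
  have hε0 : 0 ≤ m * (3 * (2 * (5 * m + 17 : ℕ) * u)) := by positivity
  set ε := m * (3 * (2 * (5 * m + 17 : ℕ) * u)) with hε
  have main : ∀ k, k ≤ n → (∀ (i : Fin m) (j : Fin n), (j : ℕ) < k → (j : ℕ) < i → B k i j = 0) ∧
      ∃ (Q : Matrix (Fin m) (Fin m) ℝ) (E : Matrix (Fin m) (Fin n) ℝ), Qᵀ * Q = 1 ∧
        B k = Q * (A + E) ∧
        ∀ j, norm2 (fun i => E i j) ≤ ((1 + ε) ^ k - 1) * norm2 (fun i => A i j) := by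
    intro k
    induction k with
    | zero =>
      intro _
      exact ⟨fun i j hj => absurd hj (Nat.not_lt_zero _), 1, 0, by simp, by simp [hB0],
        fun j => by
          rw [pow_zero, sub_self, zero_mul]
          exact norm2_zero.le⟩
    | succ k ih =>
      intro hk
      obtain ⟨htri, Q, E, hQ, hBQ, hE⟩ := ih (by omega)
      have hst := hstep ⟨k, by omega⟩
      obtain ⟨P, hP, hcol⟩ := hst.exists_orthogonal hu0 hu hmu fun i j hj hi =>
        htri i j hj (lt_of_lt_of_le hj hi)
      simp only at hcol
      obtain ⟨v, s, β, -, hkeep, -, hbelow, -⟩ := hst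
      -- The local error `B (k + 1) - P * B k` is pulled back to `A` by the transposed accumulated
      -- orthogonal matrix, which preserves column norms.
      refine ⟨fun i j hj hji => ?_, P * Q, E + (P * Q)ᵀ * (B (k + 1) - P * B k), ?_, ?_, ?_⟩
      · rcases Nat.lt_succ_iff_lt_or_eq.1 hj with hj | hj
        · rw [hkeep i j (Or.inr hj)]
          exact htri i j hj hji
        · subst hj
          exact hbelow i hji
      · rw [Matrix.transpose_mul, Matrix.mul_assoc, ← Matrix.mul_assoc Pᵀ, hP, Matrix.one_mul, hQ]
      · have hPQ : (P * Q) * (P * Q)ᵀ = 1 := by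
          rw [mul_eq_one_comm, Matrix.transpose_mul, Matrix.mul_assoc, ← Matrix.mul_assoc Pᵀ, hP,
            Matrix.one_mul, hQ]
        rw [← add_assoc, Matrix.mul_add, ← Matrix.mul_assoc (P * Q) (P * Q)ᵀ, hPQ, Matrix.one_mul,
          Matrix.mul_assoc, ← hBQ]
        abel
      · intro j
        have hPQ : (P * Q)ᵀᵀ * (P * Q)ᵀ = 1 := by
          rw [Matrix.transpose_transpose, mul_eq_one_comm, Matrix.transpose_mul, Matrix.mul_assoc,
            ← Matrix.mul_assoc Pᵀ, hP, Matrix.one_mul, hQ]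
        have h1 := norm2_add_le (fun i => E i j)
          (fun i => ((P * Q)ᵀ * (B (k + 1) - P * B k)) i j)
        rw [norm2_col_mul_of_transpose_mul_self_eq_one hPQ] at h1
        have h2 : norm2 (fun i => B k i j) ≤ (1 + ε) ^ k * norm2 (fun i => A i j) := by
          rw [hBQ, norm2_col_mul_of_transpose_mul_self_eq_one hQ]
          have := norm2_add_le (fun i => A i j) (fun i => E i j)
          have := hE j
          calc _ ≤ norm2 (fun i => A i j) + norm2 (fun i => E i j) := by assumption
            _ ≤ _ := by linarith
        calc _ ≤ norm2 (fun i => E i j) + norm2 fun i => (B (k + 1) - P * B k) i j := h1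
          _ ≤ ((1 + ε) ^ k - 1) * norm2 (fun i => A i j)
              + ε * ((1 + ε) ^ k * norm2 (fun i => A i j)) :=
              add_le_add (hE j) ((hcol j).trans (mul_le_mul_of_nonneg_left h2 hε0))
          _ = _ := by ring
  obtain ⟨htri, Q, E, hQ, hBQ, hE⟩ := main n le_rfl
  refine ⟨fun i j hij => ?_, E, ?_, hE⟩
  · rw [hR]
    exact htri _ _ j.2 hij
  -- `R` is the top block of `B n` and the rows below are zero, so both have the same Gram matrix,
  -- from which `Q` drops out.
  · have h1 : (B n)ᵀ * B n = (A + E)ᵀ * (A + E) := by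
      rw [hBQ, Matrix.transpose_mul, Matrix.mul_assoc, ← Matrix.mul_assoc Qᵀ, hQ, Matrix.one_mul]
    rw [← h1]
    ext i j
    simp only [Matrix.mul_apply, Matrix.transpose_apply, hR]
    refine Finset.sum_of_injOn (Fin.castLE hmn) (Fin.castLE_injective hmn).injOn
      (fun _ _ => Finset.mem_coe.2 (Finset.mem_univ _)) (fun l _ hl => ?_) fun _ _ => rfl
    have hl' : n ≤ (l : ℕ) := by
      by_contra hlt
      push Not at hlt
      exact hl ⟨⟨l, hlt⟩, by simp, by ext; simp⟩
    rw [htri l j j.2 (by omega), mul_zero]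

/-- Backward error of Householder QR factorization in the spectral norm. -/
theorem FlHouseholderQR.exists_norm_backward_error (m n : ℕ) :
    ∃ c C : ℝ, 0 < c ∧ 0 < C ∧ ∀ (hmn : n ≤ m) (u : ℝ) (A : Matrix (Fin m) (Fin n) ℝ)
      (R : Matrix (Fin n) (Fin n) ℝ), 0 ≤ u → c * u ≤ 1 → FlHouseholderQR hmn u A R →
      (∀ i j, j < i → R i j = 0) ∧ ∃ E : Matrix (Fin m) (Fin n) ℝ,
        Rᵀ * R = (A + E)ᵀ * (A + E) ∧ ‖E‖ ≤ C * u * ‖A‖ := by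
  have hpow : ∀ (k : ℕ) (ε : ℝ), 0 ≤ ε → ε ≤ 1 → (1 + ε) ^ k - 1 ≤ 2 ^ k * ε := by
    intro k ε h0 h1
    induction k with
    | zero => simpa using h0
    | succ k ih =>
      have : (1 + ε) ^ k ≤ 2 ^ k := pow_le_pow_left₀ (by linarith) (by linarith) k
      rw [pow_succ, pow_succ]
      nlinarith
  set c₀ : ℝ := m * (3 * (2 * (5 * m + 17 : ℕ))) with hc₀
  have hc0 : 0 ≤ c₀ := by positivity
  -- The two summands of the first constant secure `c₀ u ≤ 1` and `(5 m + 17) u ≤ 1 / 2`; the `+ 1`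
  -- in the second only makes it positive in degenerate dimensions.
  refine ⟨c₀ + 2 * (5 * m + 17 : ℕ), n * (2 ^ n * c₀) + 1, by positivity, by positivity,
    fun hmn u A R hu0 hcu h => ?_⟩
  have h1 : 0 ≤ c₀ * u := by positivity
  have h2 : 0 ≤ (5 * m + 17 : ℕ) * u := by positivity
  have h3 : (5 * m + 17 : ℕ) * u ≤ 1 / 2 := by nlinarith
  have h4 : c₀ * u ≤ 1 := by nlinarith
  have h5 : u < 1 := by
    push_cast at h3
    have : 0 ≤ m * u := by positivity
    nlinarith
  obtain ⟨htri, E, hE, hcol⟩ := h.exists_backward_error hu0 h5 h3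
  refine ⟨htri, E, hE, ?_⟩
  have h6 : m * (3 * (2 * (5 * m + 17 : ℕ) * u)) = c₀ * u := by rw [hc₀]; ring
  rw [h6] at hcol
  have h7 : ∀ j, norm2 (fun i => E i j) ≤ 2 ^ n * (c₀ * u) * ‖A‖ := fun j =>
    (hcol j).trans <| mul_le_mul (hpow n _ h1 h4) (norm2_col_le A j) (norm2_nonneg _)
      (by positivity)
  have h8 := l2_opNorm_le_of_norm2_col_le (by positivity) h7
  rw [Fintype.card_fin] at h8
  have h9 : 0 ≤ u * ‖A‖ := by positivity
  calc ‖E‖ ≤ n * (2 ^ n * (c₀ * u) * ‖A‖) := h8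
    _ ≤ (n * (2 ^ n * c₀) + 1) * u * ‖A‖ := by linarith

/-! ### Backward error of substitution -/

/-- One row of a substitution is solved exactly for slightly perturbed coefficients. -/
theorem exists_factor_of_subst_row {ι : Type*} [DecidableEq ι] {u : ℝ} (hu0 : 0 ≤ u)
    (hu : u < 1) {S : Finset ι} {i : ι} (hi : i ∉ S) {k : ℕ} (hk : S.card + 1 ≤ k) {l y : ι → ℝ}
    (hl : l i ≠ 0) {c z : ℝ} (hz : FlSubDot u S c l y z) (hy : Rounds u (z / l i) (y i)) :
    ∃ t : ι → ℝ, (∀ j, RelFactor u (2 * k + 2) (t j)) ∧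
      ∑ j ∈ insert i S, l j * t j * y j = c := by
  obtain ⟨τ, t, hτ, ht, rfl⟩ := hz.exists_factor hu0 hu
  obtain ⟨f, hf, hyf⟩ := hy.exists_factor hu0 hu
  have hτ0 := (hτ.pos hu).ne'
  have hf0 := (hf.pos hu).ne'
  -- Dividing the row by `τ` moves the error of the right-hand side into the coefficients, so `c`
  -- stays exact.
  refine ⟨fun j => if j = i then f⁻¹ * τ⁻¹ else if j ∈ S then t j * τ⁻¹ else 1, fun j => ?_, ?_⟩
  · dsimp only
    split_ifs with h1 h2
    · exact ((hf.inv hu).mul hu (hτ.inv hu)).mono hu0 hu (by omega)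
    · exact ((ht j h2).mul hu (hτ.inv hu)).mono hu0 hu (by omega)
    · exact RelFactor.one hu0 hu _
  · have h1 : ∑ j ∈ S, l j * (if j = i then f⁻¹ * τ⁻¹ else if j ∈ S then t j * τ⁻¹ else 1) * y j
        = (∑ j ∈ S, l j * y j * t j) * τ⁻¹ := by
      rw [Finset.sum_mul]
      refine Finset.sum_congr rfl fun j hj => ?_
      rw [if_neg (by rintro rfl; exact hi hj), if_pos hj]
      ring
    rw [Finset.sum_insert hi, h1]
    simp only [if_true]
    nth_rewrite 1 [hyf]
    field_simp
    ring

theorem exists_backward_error_of_subst_rows {n : ℕ} {u : ℝ} (hu0 : 0 ≤ u) (hu : u < 1)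
    {L : Matrix (Fin n) (Fin n) ℝ} {g y : Fin n → ℝ} (S : Fin n → Finset (Fin n))
    (hS : ∀ i, i ∉ S i) (hL : ∀ i j, j ∉ insert i (S i) → L i j = 0) (hdiag : ∀ i, L i i ≠ 0)
    (h : ∀ i, ∃ z, FlSubDot u (S i) (g i) (L i) y z ∧ Rounds u (z / L i i) (y i)) :
    ∃ L' : Matrix (Fin n) (Fin n) ℝ,
      (∀ i j, ∃ t, RelFactor u (2 * n + 2) t ∧ L' i j = L i j * t) ∧ L' *ᵥ y = g := by
  have hrow : ∀ i, ∃ t : Fin n → ℝ, (∀ j, RelFactor u (2 * n + 2) (t j)) ∧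
      ∑ j ∈ insert i (S i), L i j * t j * y j = g i := by
    intro i
    obtain ⟨z, hz, hy⟩ := h i
    refine exists_factor_of_subst_row hu0 hu (hS i) ?_ (hdiag i) hz hy
    rw [← Finset.card_insert_of_notMem (hS i)]
    exact (Finset.card_le_univ _).trans_eq (by simp)
  choose t ht hsum using hrow
  refine ⟨Matrix.of fun i j => L i j * t i j, fun i j => ⟨t i j, ht i j, rfl⟩, ?_⟩
  funext i
  rw [← hsum i]
  symm
  refine Finset.sum_subset (Finset.subset_univ _) fun j _ hj => ?_
  rw [hL i j hj, zero_mul, zero_mul]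

theorem FlForwardSubst.exists_backward_error {n : ℕ} {u : ℝ} (hu0 : 0 ≤ u) (hu : u < 1)
    {L : Matrix (Fin n) (Fin n) ℝ} {g y : Fin n → ℝ} (hL : ∀ i j, i < j → L i j = 0)
    (hdiag : ∀ i, L i i ≠ 0) (h : FlForwardSubst u L g y) :
    ∃ L' : Matrix (Fin n) (Fin n) ℝ,
      (∀ i j, ∃ t, RelFactor u (2 * n + 2) t ∧ L' i j = L i j * t) ∧ L' *ᵥ y = g :=
  exists_backward_error_of_subst_rows hu0 hu (fun i => Finset.Iio i) (by simp)
    (fun i j hj => hL i j (by simpa using hj)) hdiag h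

theorem FlBackSubst.exists_backward_error {n : ℕ} {u : ℝ} (hu0 : 0 ≤ u) (hu : u < 1)
    {L : Matrix (Fin n) (Fin n) ℝ} {g y : Fin n → ℝ} (hL : ∀ i j, j < i → L i j = 0)
    (hdiag : ∀ i, L i i ≠ 0) (h : FlBackSubst u L g y) :
    ∃ L' : Matrix (Fin n) (Fin n) ℝ,
      (∀ i j, ∃ t, RelFactor u (2 * n + 2) t ∧ L' i j = L i j * t) ∧ L' *ᵥ y = g :=
  exists_backward_error_of_subst_rows hu0 hu (fun i => Finset.Ioi i) (by simp)
    (fun i j hj => hL i j (by simpa using hj)) hdiag h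

/-- Entrywise relative perturbations are small in norm. -/
theorem norm_sub_le_of_factor {n k : ℕ} {u : ℝ} (hu0 : 0 ≤ u) (hu : u < 1)
    (hk : k * u ≤ 1 / 2) {R R' : Matrix (Fin n) (Fin n) ℝ}
    (h : ∀ i j, ∃ t, RelFactor u k t ∧ R' i j = R i j * t) :
    ‖R' - R‖ ≤ n * (n * (2 * k * u * ‖R‖)) := by
  have := l2_opNorm_le_of_abs_entry_le (M := R' - R) (a := 2 * k * u * ‖R‖) (by positivity)
    fun i j => by
      obtain ⟨t, ht, hR⟩ := h i j
      rw [Matrix.sub_apply, hR, show R i j * t - R i j = (t - 1) * R i j by ring, abs_mul]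
      exact mul_le_mul (ht.abs_sub_one_le hu0 hu hk) (abs_entry_le R i j) (abs_nonneg _)
        (by positivity)
  simpa using this

/-! ### Perturbation of the semi-normal equations -/

theorem pinv_mul_self {m n : ℕ} {A : Matrix (Fin m) (Fin n) ℝ} (hA : A.rank = n) :
    pinv A * A = 1 := by
  have hinj : Function.Injective A.mulVec := by
    have h := LinearMap.finrank_range_add_finrank_ker A.mulVecLin
    rw [← Matrix.rank, hA, Module.finrank_fin_fun, Nat.add_eq_left] at h
    exact LinearMap.ker_eq_bot.1 (Submodule.finrank_eq_zero.1 h)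
  have h := (pinv_penrose A hA).1
  refine Matrix.ext_of_mulVec_single fun i => hinj ?_
  rw [Matrix.mulVec_mulVec, ← Matrix.mul_assoc, h, Matrix.one_mulVec]

theorem norm2_le_norm_pinv_mul {m n : ℕ} {A : Matrix (Fin m) (Fin n) ℝ} (hA : A.rank = n)
    (z : Fin n → ℝ) : norm2 z ≤ ‖pinv A‖ * norm2 (A *ᵥ z) := by
  calc norm2 z = norm2 (pinv A *ᵥ A *ᵥ z) := by
        rw [Matrix.mulVec_mulVec, pinv_mul_self hA, Matrix.one_mulVec]
    _ ≤ _ := norm2_mulVec_le _ _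

theorem one_le_kappa {m n : ℕ} {A : Matrix (Fin m) (Fin n) ℝ} (hA : A.rank = n)
    {x : Fin n → ℝ} (hx : x ≠ 0) : 1 ≤ kappa A := by
  have h0 : 0 < norm2 x :=
    (norm2_nonneg x).lt_of_ne fun h => hx (norm2_eq_zero.1 h.symm)
  have h := (norm2_le_norm_pinv_mul hA x).trans
    (mul_le_mul_of_nonneg_left (norm2_mulVec_le A x) (norm_nonneg _))
  rw [kappa]
  by_contra hlt
  push Not at hlt
  nlinarith

/-- The lower bound on `W` forces injectivity, and applied to `W⁻¹ z` it bounds the inverse. -/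
theorem isUnit_det_and_norm_inv_le {n : ℕ} {W : Matrix (Fin n) (Fin n) ℝ} {a : ℝ} (ha : 0 ≤ a)
    (h : ∀ z, norm2 z ≤ a * norm2 (W *ᵥ z)) : IsUnit W.det ∧ ‖W⁻¹‖ ≤ a := by
  have hdet : IsUnit W.det := by
    rw [← Matrix.isUnit_iff_isUnit_det, ← Matrix.mulVec_injective_iff_isUnit]
    intro y z hyz
    have := h (y - z)
    rw [Matrix.mulVec_sub, sub_eq_zero.2 hyz, norm2_zero, mul_zero] at this
    exact sub_eq_zero.1 (norm2_eq_zero.1 (this.antisymm (norm2_nonneg _)))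
  refine ⟨hdet, l2_opNorm_le_of_forall ha fun z => ?_⟩
  have := h (W⁻¹ *ᵥ z)
  rwa [Matrix.mulVec_mulVec, Matrix.mul_nonsing_inv _ hdet, Matrix.one_mulVec] at this

theorem norm2_mulVec_eq_of_gram_eq {k m n : ℕ} {B : Matrix (Fin k) (Fin n) ℝ}
    {C : Matrix (Fin m) (Fin n) ℝ} (h : Bᵀ * B = Cᵀ * C) (z : Fin n → ℝ) :
    norm2 (B *ᵥ z) = norm2 (C *ᵥ z) := by
  have key : ∀ {l : ℕ} (M : Matrix (Fin l) (Fin n) ℝ),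
      norm2 (M *ᵥ z) ^ 2 = ((Mᵀ * M) *ᵥ z) ⬝ᵥ z := by
    intro l M
    rw [norm2_sq_eq_dotProduct, Matrix.dotProduct_mulVec, ← Matrix.mulVec_transpose,
      Matrix.mulVec_mulVec]
  have h1 : norm2 (B *ᵥ z) ^ 2 = norm2 (C *ᵥ z) ^ 2 := by rw [key, key, h]
  exact (sq_eq_sq₀ (norm2_nonneg _) (norm2_nonneg _)).1 h1

section SemiNormal

variable {m n : ℕ} {A E : Matrix (Fin m) (Fin n) ℝ} {R : Matrix (Fin n) (Fin n) ℝ} {ε δ : ℝ}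

theorem norm_le_two_mul_of_gram_eq (hR : Rᵀ * R = (A + E)ᵀ * (A + E)) (hE : ‖E‖ ≤ ε * ‖A‖)
    (hε : ε ≤ 1) : ‖R‖ ≤ 2 * ‖A‖ := by
  have h1 : ‖R‖ * ‖R‖ = ‖A + E‖ * ‖A + E‖ := by
    rw [← l2_opNorm_transpose_mul_self, hR, l2_opNorm_transpose_mul_self]
  have h2 : ‖R‖ = ‖A + E‖ := (mul_self_inj (norm_nonneg _) (norm_nonneg _)).1 h1
  have h3 := norm_add_le A E
  have h4 := mul_le_mul_of_nonneg_right hε (norm_nonneg A)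
  linarith

/-- Equal Gram matrices give `‖R z‖ = ‖(A + E) z‖`, so `‖W z‖` differs from `‖A z‖` by at most `(ε +
δ)‖A‖‖z‖`. Multiplied by `‖A†‖` this is at most `‖z‖ / 2` and is absorbed, which doubles the bound.
-/
theorem isUnit_det_and_norm_inv_le_of_gram_eq (hA : A.rank = n)
    (hR : Rᵀ * R = (A + E)ᵀ * (A + E)) (hE : ‖E‖ ≤ ε * ‖A‖) {W : Matrix (Fin n) (Fin n) ℝ}
    (hW : ‖W - R‖ ≤ δ * ‖A‖) (hκ : (ε + δ) * kappa A ≤ 1 / 2) :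
    IsUnit W.det ∧ ‖W⁻¹‖ ≤ 2 * ‖pinv A‖ := by
  refine isUnit_det_and_norm_inv_le (by positivity) fun z => ?_
  have hz := norm2_nonneg z
  have h1 := norm2_le_norm_pinv_mul hA z
  have h2 : norm2 (A *ᵥ z) ≤ norm2 (R *ᵥ z) + ε * ‖A‖ * norm2 z := by
    rw [norm2_mulVec_eq_of_gram_eq hR]
    calc norm2 (A *ᵥ z) = norm2 ((A + E) *ᵥ z - E *ᵥ z) := by
          rw [Matrix.add_mulVec, add_sub_cancel_right]
      _ ≤ norm2 ((A + E) *ᵥ z) + norm2 (E *ᵥ z) := norm2_sub_le _ _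
      _ ≤ _ := by
        gcongr
        exact (norm2_mulVec_le E z).trans (mul_le_mul_of_nonneg_right hE hz)
  have h3 : norm2 (R *ᵥ z) ≤ norm2 (W *ᵥ z) + δ * ‖A‖ * norm2 z := by
    calc norm2 (R *ᵥ z) = norm2 (W *ᵥ z - (W - R) *ᵥ z) := by
          rw [Matrix.sub_mulVec, sub_sub_cancel]
      _ ≤ norm2 (W *ᵥ z) + norm2 ((W - R) *ᵥ z) := norm2_sub_le _ _
      _ ≤ _ := by
        gcongr
        exact (norm2_mulVec_le _ z).trans (mul_le_mul_of_nonneg_right hW hz)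
  have h4 : norm2 z ≤ ‖pinv A‖ * norm2 (W *ᵥ z) + (ε + δ) * kappa A * norm2 z := by
    calc norm2 z ≤ ‖pinv A‖ * norm2 (A *ᵥ z) := h1
      _ ≤ ‖pinv A‖ * (norm2 (W *ᵥ z) + δ * ‖A‖ * norm2 z + ε * ‖A‖ * norm2 z) := by
        gcongr
        linarith
      _ = _ := by rw [kappa]; ring
  have h5 := mul_le_mul_of_nonneg_right hκ hz
  linarith

/-- The solution of slightly perturbed semi-normal equations is close to every approximate
solution of the normal equations. -/
theorem norm2_sub_le_of_seminormal_solve (hA : A.rank = n)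
    (hR : Rᵀ * R = (A + E)ᵀ * (A + E)) (hE : ‖E‖ ≤ ε * ‖A‖) (hε0 : 0 ≤ ε) (hε : ε ≤ 1)
    (hδ0 : 0 ≤ δ) (hδ : δ ≤ 1) (hκ : (ε + δ) * kappa A ≤ 1 / 2)
    {W V : Matrix (Fin n) (Fin n) ℝ} (hW : ‖W - R‖ ≤ δ * ‖A‖) (hV : ‖V - R‖ ≤ δ * ‖A‖)
    {g y d : Fin n → ℝ} (hy : Wᵀ *ᵥ y = g) (hd : V *ᵥ d = y) (e : Fin n → ℝ) :
    norm2 (e - d) ≤ 4 * ‖pinv A‖ ^ 2 *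
      ((3 * ε + 5 * δ) * ‖A‖ ^ 2 * norm2 e + norm2 ((Aᵀ * A) *ᵥ e - g)) := by
  obtain ⟨hWu, hWi⟩ := isUnit_det_and_norm_inv_le_of_gram_eq hA hR hE hW hκ
  obtain ⟨hVu, hVi⟩ := isUnit_det_and_norm_inv_le_of_gram_eq hA hR hE hV hκ
  have hRn := norm_le_two_mul_of_gram_eq hR hE hε
  have hWu' : IsUnit (Wᵀ).det := by rwa [Matrix.det_transpose]
  have hWi' : ‖(Wᵀ)⁻¹‖ ≤ 2 * ‖pinv A‖ := by
    rwa [← Matrix.transpose_nonsing_inv, l2_opNorm_transpose]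
  have h1 : e - d = V⁻¹ *ᵥ ((Wᵀ)⁻¹ *ᵥ ((Wᵀ * V) *ᵥ e - g)) := by
    rw [← hy, ← hd, ← Matrix.mulVec_mulVec e, ← Matrix.mulVec_sub, ← Matrix.mulVec_sub,
      Matrix.mulVec_mulVec _ (Wᵀ)⁻¹, Matrix.nonsing_inv_mul _ hWu', Matrix.one_mulVec,
      Matrix.mulVec_mulVec, Matrix.nonsing_inv_mul _ hVu, Matrix.one_mulVec]
  have h2 : norm2 (e - d) ≤ (2 * ‖pinv A‖) * ((2 * ‖pinv A‖) * norm2 ((Wᵀ * V) *ᵥ e - g)) := by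
    rw [h1]
    refine (norm2_mulVec_le _ _).trans (mul_le_mul hVi ?_ (norm2_nonneg _) (by positivity))
    exact (norm2_mulVec_le _ _).trans (mul_le_mul_of_nonneg_right hWi' (norm2_nonneg _))
  have hA0 := norm_nonneg A
  have h3 : ‖Wᵀ * V - Aᵀ * A‖ ≤ (3 * ε + 5 * δ) * ‖A‖ ^ 2 := by
    have hdec : Wᵀ * V - Aᵀ * A = (Aᵀ * E + Eᵀ * A + Eᵀ * E)
        + ((W - R)ᵀ * R + Rᵀ * (V - R) + (W - R)ᵀ * (V - R)) := by
      have : Rᵀ * R = Aᵀ * A + (Aᵀ * E + Eᵀ * A + Eᵀ * E) := by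
        rw [hR, Matrix.transpose_add, Matrix.add_mul, Matrix.mul_add, Matrix.mul_add]
        abel
      rw [← sub_eq_iff_eq_add'.2 this, Matrix.transpose_sub]
      simp only [Matrix.sub_mul, Matrix.mul_sub]
      abel
    have hmul : ∀ {k l q : ℕ} (X : Matrix (Fin l) (Fin k) ℝ) (Y : Matrix (Fin l) (Fin q) ℝ)
        {a b : ℝ}, ‖X‖ ≤ a → ‖Y‖ ≤ b → ‖Xᵀ * Y‖ ≤ a * b := fun X Y a b hX hY =>
      (Matrix.l2_opNorm_mul _ _).trans (mul_le_mul (by rwa [l2_opNorm_transpose]) hY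
        (norm_nonneg _) ((norm_nonneg _).trans hX))
    -- The terms in `E` give `2 ε + ε² ≤ 3 ε`; those in `W - R` and `V - R` give `4 δ + δ² ≤ 5 δ`,
    -- since `‖R‖ ≤ 2‖A‖`.
    rw [hdec]
    calc _ ≤ (‖A‖ * (ε * ‖A‖) + ε * ‖A‖ * ‖A‖ + ε * ‖A‖ * (ε * ‖A‖))
          + (δ * ‖A‖ * (2 * ‖A‖) + 2 * ‖A‖ * (δ * ‖A‖) + δ * ‖A‖ * (δ * ‖A‖)) :=
          norm_add_le_of_le
            (norm_add_le_of_le (norm_add_le_of_le (hmul _ _ le_rfl hE) (hmul _ _ hE le_rfl))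
              (hmul _ _ hE hE))
            (norm_add_le_of_le (norm_add_le_of_le (hmul _ _ hW hRn) (hmul _ _ hRn hV))
              (hmul _ _ hW hV))
      _ ≤ _ := by
        have h5 : ε * ε ≤ ε := mul_le_of_le_one_left hε0 hε
        have h6 : δ * δ ≤ δ := mul_le_of_le_one_left hδ0 hδ
        have h7 := mul_le_mul_of_nonneg_right (add_le_add h5 h6) (sq_nonneg ‖A‖)
        linarith
  have h4 : norm2 ((Wᵀ * V) *ᵥ e - g)
      ≤ (3 * ε + 5 * δ) * ‖A‖ ^ 2 * norm2 e + norm2 ((Aᵀ * A) *ᵥ e - g) := by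
    calc norm2 ((Wᵀ * V) *ᵥ e - g)
        = norm2 ((Wᵀ * V - Aᵀ * A) *ᵥ e + ((Aᵀ * A) *ᵥ e - g)) := by
          rw [Matrix.sub_mulVec, sub_add_sub_cancel]
      _ ≤ norm2 ((Wᵀ * V - Aᵀ * A) *ᵥ e) + norm2 ((Aᵀ * A) *ᵥ e - g) := norm2_add_le _ _
      _ ≤ _ := by
        gcongr
        exact (norm2_mulVec_le _ _).trans (mul_le_mul_of_nonneg_right h3 (norm2_nonneg e))
  calc norm2 (e - d) ≤ 4 * ‖pinv A‖ ^ 2 * norm2 ((Wᵀ * V) *ᵥ e - g) := by linarith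
    _ ≤ _ := by gcongr

end SemiNormal

/-- The residual of a least squares solution is orthogonal to the range. -/
theorem IsLeastSquaresSolution.normal_equations {m n : ℕ} {A : Matrix (Fin m) (Fin n) ℝ}
    {b : Fin m → ℝ} {x : Fin n → ℝ} (h : IsLeastSquaresSolution A b x) :
    Aᵀ *ᵥ (b - A *ᵥ x) = 0 := by
  set r := b - A *ᵥ x with hr
  set w := Aᵀ *ᵥ r with hw
  clear_value w r
  have hrw : r ⬝ᵥ (A *ᵥ w) = norm2 w ^ 2 := by
    rw [norm2_sq_eq_dotProduct, Matrix.dotProduct_mulVec, ← Matrix.mulVec_transpose, hw]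
  -- Minimality is tested along `w = Aᵀ r`. The step length `‖w‖² / (a + 1)` used below is the
  -- optimal one with a denominator that cannot vanish.
  have h1 : ∀ t : ℝ, 2 * t * norm2 w ^ 2 ≤ t ^ 2 * norm2 (A *ᵥ w) ^ 2 := by
    intro t
    have h2 := h (x + t • w)
    have h3 : b - A *ᵥ (x + t • w) = r - t • (A *ᵥ w) := by
      rw [Matrix.mulVec_add, Matrix.mulVec_smul, hr]
      abel
    rw [h3, ← hr] at h2
    have h4 := pow_le_pow_left₀ (norm2_nonneg _) h2 2
    rw [norm2_sq_eq_dotProduct, norm2_sq_eq_dotProduct (r - _), sub_dotProduct, dotProduct_sub,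
      dotProduct_sub, smul_dotProduct, smul_dotProduct, dotProduct_smul, dotProduct_smul,
      dotProduct_comm (A *ᵥ w) r, hrw, ← norm2_sq_eq_dotProduct (A *ᵥ w)] at h4
    simp only [smul_eq_mul] at h4
    linarith
  by_contra hne
  have hpos : 0 < norm2 w := (norm2_nonneg w).lt_of_ne fun h => hne (norm2_eq_zero.1 h.symm)
  set a := norm2 (A *ᵥ w) ^ 2 with ha
  have ha0 : 0 ≤ a := sq_nonneg _
  have h2 := h1 (norm2 w ^ 2 / (a + 1))
  rw [div_pow, mul_div_assoc', div_mul_eq_mul_div, div_mul_eq_mul_div, div_le_div_iff₀ (by positivity)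
    (by positivity)] at h2
  have h3 : 0 < norm2 w ^ 4 * (a + 1) := by positivity
  nlinarith

/-! ### One step of iterative refinement -/

theorem norm2_residual_sub_le {m n : ℕ} {u : ℝ} (hu0 : 0 ≤ u) (hu : u < 1)
    (hK : (m + n + 2 : ℕ) * u ≤ 1 / 2) {A : Matrix (Fin m) (Fin n) ℝ} {b r : Fin m → ℝ}
    {x : Fin n → ℝ} (h : ∀ i, FlSubDot u Finset.univ (b i) (A i) x (r i)) :
    norm2 (r - (b - A *ᵥ x)) ≤
      m * ((n + 1) * (2 * (m + n + 2 : ℕ) * u) * (norm2 b + ‖A‖ * norm2 x)) := by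
  set ε := 2 * (m + n + 2 : ℕ) * u with hε
  have hε0 : 0 ≤ ε := by positivity
  have hb := norm2_nonneg b
  have hx := norm2_nonneg x
  have hAx : 0 ≤ ‖A‖ * norm2 x := by positivity
  have key : ∀ i, |(r - (b - A *ᵥ x)) i| ≤ (n + 1) * ε * (norm2 b + ‖A‖ * norm2 x) := by
    intro i
    obtain ⟨τ, t, hτ, ht, hri⟩ := (h i).exists_factor hu0 hu
    rw [Finset.card_univ, Fintype.card_fin] at hτ ht
    have hτ' := (hτ.mono hu0 hu (show _ ≤ m + n + 2 by omega)).abs_sub_one_le hu0 hu hK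
    have ht' := fun j => ((ht j (Finset.mem_univ j)).mono hu0 hu
      (show _ ≤ m + n + 2 by omega)).abs_sub_one_le hu0 hu hK
    have h1 : (r - (b - A *ᵥ x)) i = b i * (τ - 1) - ∑ j, A i j * x j * (t j - 1) := by
      simp only [Pi.sub_apply, hri, Matrix.mulVec, dotProduct, mul_sub, Finset.sum_sub_distrib,
        mul_one]
      ring
    have h2 : |b i * (τ - 1)| ≤ norm2 b * ε := by
      rw [abs_mul]
      exact mul_le_mul (abs_le_norm2 b i) hτ' (abs_nonneg _) hb
    have h3 : |∑ j, A i j * x j * (t j - 1)| ≤ n * (‖A‖ * norm2 x * ε) := by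
      refine (Finset.abs_sum_le_sum_abs _ _).trans ?_
      calc _ ≤ ∑ _j : Fin n, ‖A‖ * norm2 x * ε := by
            refine Finset.sum_le_sum fun j _ => ?_
            rw [abs_mul, abs_mul]
            exact mul_le_mul (mul_le_mul (abs_entry_le A i j) (abs_le_norm2 x j) (abs_nonneg _)
              (norm_nonneg _)) (ht' j) (abs_nonneg _) hAx
        _ = _ := by simp
    rw [h1]
    refine (abs_sub _ _).trans ((add_le_add h2 h3).trans ?_)
    have h4 : 0 ≤ n * (norm2 b * ε) := by positivity
    have h5 : 0 ≤ ‖A‖ * norm2 x * ε := by positivity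
    linarith
  simpa using norm2_le_card_mul key

theorem norm2_transpose_mulVec_sub_le {m n : ℕ} {u : ℝ} (hu0 : 0 ≤ u) (hu : u < 1)
    (hK : (m + n + 2 : ℕ) * u ≤ 1 / 2) {A : Matrix (Fin m) (Fin n) ℝ} {r : Fin m → ℝ}
    {h : Fin n → ℝ} (hh : ∀ j, FlDot u Finset.univ (fun i => A i j) r (h j)) :
    norm2 (h - Aᵀ *ᵥ r) ≤ n * (2 * (m + n + 2 : ℕ) * u * (‖A‖ * norm2 r)) := by
  set ε := 2 * (m + n + 2 : ℕ) * u with hε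
  have hε0 : 0 ≤ ε := by positivity
  have key : ∀ j, |(h - Aᵀ *ᵥ r) j| ≤ ε * (‖A‖ * norm2 r) := by
    intro j
    obtain ⟨t, ht, hhj⟩ := (hh j).exists_factor hu0 hu
    rw [Finset.card_univ, Fintype.card_fin] at ht
    have ht' := fun i => ((ht i (Finset.mem_univ i)).mono hu0 hu
      (show _ ≤ m + n + 2 by omega)).abs_sub_one_le hu0 hu hK
    have h1 : (h - Aᵀ *ᵥ r) j = ∑ i, A i j * r i * (t i - 1) := by
      simp only [Pi.sub_apply, hhj, Matrix.mulVec, dotProduct, mul_sub, Finset.sum_sub_distrib,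
        mul_one, Matrix.transpose_apply]
    rw [h1]
    calc _ ≤ ∑ i, |A i j| * |r i| * ε := by
          refine (Finset.abs_sum_le_sum_abs _ _).trans (Finset.sum_le_sum fun i _ => ?_)
          rw [abs_mul, abs_mul]
          exact mul_le_mul_of_nonneg_left (ht' i) (by positivity)
      _ ≤ (norm2 (fun i => A i j) * norm2 r) * ε := by
          rw [← Finset.sum_mul]
          exact mul_le_mul_of_nonneg_right (sum_abs_mul_abs_le (fun i => A i j) r) hε0
      _ ≤ ‖A‖ * norm2 r * ε := by
          have := norm2_nonneg r
          gcongr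
          exact norm2_col_le A j
      _ = _ := by ring
  simpa using norm2_le_card_mul key

theorem norm2_sub_le_of_forall_rounds {n : ℕ} {u : ℝ} (hu0 : 0 ≤ u) {x z : Fin n → ℝ}
    (h : ∀ j, |z j - x j| ≤ u * |x j|) : norm2 (z - x) ≤ u * norm2 x := by
  refine le_of_sq_le_sq ?_ (mul_nonneg hu0 (norm2_nonneg x))
  rw [mul_pow, norm2_sq, norm2_sq, Finset.mul_sum]
  refine Finset.sum_le_sum fun j _ => ?_
  rw [Pi.sub_apply, ← sq_abs, ← sq_abs (x j), ← mul_pow]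
  exact pow_le_pow_left₀ (abs_nonneg _) (h j) 2

/-- Forward error of the computed right-hand side `Aᵀ (b - A x)`, rounded to precision `u`. -/
theorem exists_norm2_rhs_sub_le (m n : ℕ) :
    ∃ c C : ℝ, 0 < c ∧ 0 < C ∧ ∀ (u ur : ℝ) (A : Matrix (Fin m) (Fin n) ℝ) (b r : Fin m → ℝ)
      (x h g : Fin n → ℝ), 0 ≤ u → u ≤ 1 → 0 ≤ ur → c * ur ≤ 1 →
      (∀ i, FlSubDot ur Finset.univ (b i) (A i) x (r i)) →
      (∀ j, FlDot ur Finset.univ (fun i => A i j) r (h j)) → (∀ j, Rounds u (h j) (g j)) →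
      norm2 (Aᵀ *ᵥ (b - A *ᵥ x) - g) ≤ u * norm2 (Aᵀ *ᵥ (b - A *ᵥ x))
        + C * ur * ‖A‖ * (norm2 b + ‖A‖ * norm2 x) := by
  set K : ℝ := 2 * (m + n + 2 : ℕ) with hK
  have hK2 : 2 ≤ K := by
    rw [hK]
    push_cast
    have : (0 : ℝ) ≤ m := by positivity
    have : (0 : ℝ) ≤ n := by positivity
    linarith
  set D : ℝ := m * (n + 1) * K with hD
  have hD0 : 0 ≤ D := by positivity
  -- `D` measures the error of the residual and `n K (1 + D)` that of the product with `Aᵀ`; the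
  -- final rounding, with `u ≤ 1`, at most doubles their sum.
  refine ⟨K, 2 * (n * K * (1 + D) + D) + 1, by positivity, by positivity, ?_⟩
  intro u ur A b r x h g hu0 hu1 hur0 hc hr hh hg
  have hK' : (m + n + 2 : ℕ) * ur ≤ 1 / 2 := by rw [hK] at hc; linarith
  have hur : ur < 1 := by nlinarith
  set β := norm2 b + ‖A‖ * norm2 x with hβ
  have hb := norm2_nonneg b
  have hx := norm2_nonneg x
  have hβ0 : 0 ≤ β := by positivity
  have hA0 := norm_nonneg A
  set e := b - A *ᵥ x with he
  have h1 : norm2 (r - e) ≤ D * ur * β :=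
    (norm2_residual_sub_le hur0 hur hK' hr).trans_eq (by rw [hD]; ring)
  have hen : norm2 e ≤ β :=
    (norm2_sub_le _ _).trans (add_le_add le_rfl (norm2_mulVec_le A x))
  have hrn : norm2 r ≤ (1 + D) * β := by
    calc norm2 r = norm2 (e + (r - e)) := by rw [add_sub_cancel]
      _ ≤ norm2 e + norm2 (r - e) := norm2_add_le _ _
      _ ≤ β + D * 1 * β := by
        have : D * ur * β ≤ D * 1 * β := by gcongr
        linarith
      _ = _ := by ring
  have h2 : norm2 (h - Aᵀ *ᵥ r) ≤ n * K * (1 + D) * ur * ‖A‖ * β := by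
    refine (norm2_transpose_mulVec_sub_le hur0 hur hK' hh).trans ?_
    calc (n : ℝ) * (K * ur * (‖A‖ * norm2 r)) ≤ n * (K * ur * (‖A‖ * ((1 + D) * β))) := by gcongr
      _ = _ := by ring
  have h3 : norm2 (h - Aᵀ *ᵥ e) ≤ (n * K * (1 + D) + D) * ur * ‖A‖ * β := by
    calc norm2 (h - Aᵀ *ᵥ e) = norm2 ((h - Aᵀ *ᵥ r) + Aᵀ *ᵥ (r - e)) := by
          rw [Matrix.mulVec_sub _ r, sub_add_sub_cancel]
      _ ≤ norm2 (h - Aᵀ *ᵥ r) + norm2 (Aᵀ *ᵥ (r - e)) := norm2_add_le _ _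
      _ ≤ n * K * (1 + D) * ur * ‖A‖ * β + ‖A‖ * (D * ur * β) := by
        refine add_le_add h2 ((norm2_mulVec_le _ _).trans ?_)
        rw [l2_opNorm_transpose]
        gcongr
      _ = _ := by ring
  have h4 : norm2 h ≤ norm2 (Aᵀ *ᵥ e) + (n * K * (1 + D) + D) * ur * ‖A‖ * β := by
    calc norm2 h = norm2 (Aᵀ *ᵥ e + (h - Aᵀ *ᵥ e)) := by rw [add_sub_cancel]
      _ ≤ _ := (norm2_add_le _ _).trans (add_le_add le_rfl h3)
  have h5 : norm2 (g - h) ≤ u * norm2 h := norm2_sub_le_of_forall_rounds hu0 fun j => (hg j).1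
  have h6 : 0 ≤ ur * ‖A‖ * β := by positivity
  have h7 : 0 ≤ (n * K * (1 + D) + D) * ur * ‖A‖ * β := by positivity
  rw [norm2_sub_rev]
  calc norm2 (g - Aᵀ *ᵥ e) = norm2 ((g - h) + (h - Aᵀ *ᵥ e)) := by rw [sub_add_sub_cancel]
    _ ≤ norm2 (g - h) + norm2 (h - Aᵀ *ᵥ e) := norm2_add_le _ _
    _ ≤ u * (norm2 (Aᵀ *ᵥ e) + (n * K * (1 + D) + D) * ur * ‖A‖ * β)
        + (n * K * (1 + D) + D) * ur * ‖A‖ * β :=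
      add_le_add (h5.trans (mul_le_mul_of_nonneg_left h4 hu0)) h3
    _ ≤ _ := by
      have := mul_le_mul_of_nonneg_right hu1 h7
      linarith

/-- Absolute form of the forward error bound for one refinement step. -/
theorem exists_seminormal_step_bound (m n : ℕ) (hmn : n ≤ m) :
    ∃ c C₁ C₂ : ℝ, 4 ≤ c ∧ 0 < C₁ ∧ 0 < C₂ ∧
      ∀ (u ur : ℝ) (A : Matrix (Fin m) (Fin n) ℝ) (b : Fin m → ℝ)
        (R : Matrix (Fin n) (Fin n) ℝ) (xs x x' : Fin n → ℝ),
        0 < u → 0 < ur → ur ≤ u ^ 2 → A.rank = n → c * u * kappa A < 1 →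
        IsLeastSquaresSolution A b xs → xs ≠ 0 → FlHouseholderQR hmn u A R →
        FlSemiNormalStep u ur A b R x x' →
        norm2 (xs - x') ≤ C₁ * u * kappa A ^ 2 * norm2 (xs - x) + u * norm2 x'
          + C₂ * ur * ‖pinv A‖ ^ 2 * (‖A‖ * (‖A‖ * norm2 x + norm2 b)) := by
  obtain ⟨c₁, C₁, hc₁, hC₁, hqr⟩ := FlHouseholderQR.exists_norm_backward_error m n
  obtain ⟨c₂, C₂, hc₂, hC₂, hrhs⟩ := exists_norm2_rhs_sub_le m n
  set K : ℝ := ((2 * n + 2 : ℕ) : ℝ) with hK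
  have hK0 : 0 ≤ K := by positivity
  set D : ℝ := 4 * n * n * K with hD
  have hD0 : 0 ≤ D := by positivity
  -- Each summand of `c` secures one smallness condition; `2 C₁ + 2 D` is the part that needs the
  -- factor `κ(A)`. In the second constant, `3 C₁` comes from QR, `5 D` from the substitutions and
  -- `1` from rounding the right-hand side.
  refine ⟨c₁ + c₂ + 2 * C₁ + 2 * D + 2 * K + 4, 4 * (3 * C₁ + 5 * D + 1), 4 * C₂,
    by linarith, by positivity, by positivity, ?_⟩
  intro u ur A b R xs x x' hu hur huru hA hcu hls hxs hQR hstep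
  have hκ := one_le_kappa hA hxs
  have hcu1 : (c₁ + c₂ + 2 * C₁ + 2 * D + 2 * K + 4) * u ≤ 1 :=
    (le_mul_of_one_le_right (by positivity) hκ).trans hcu.le
  have p1 : 0 ≤ c₁ * u := by positivity
  have p2 : 0 ≤ c₂ * u := by positivity
  have p3 : 0 ≤ C₁ * u := by positivity
  have p4 : 0 ≤ D * u := by positivity
  have p5 : 0 ≤ K * u := by positivity
  have hu1 : u < 1 := by linarith
  have hurle : ur ≤ u := huru.trans (by nlinarith)
  have hc₂ur : c₂ * ur ≤ 1 := (mul_le_mul_of_nonneg_left hurle hc₂.le).trans (by linarith)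
  have hsmall : (C₁ * u + D * u) * kappa A ≤ 1 / 2 := by
    have q : 0 ≤ (c₁ * u + c₂ * u + 2 * (K * u) + 4 * u) * kappa A := by positivity
    linarith
  obtain ⟨htri, E, hRE, hE⟩ := hqr hmn u A R hu.le (by linarith) hQR
  obtain ⟨r, h, g, y, d, hr, hh, hg, hfs, hbs, hx'⟩ := hstep
  have hRn := norm_le_two_mul_of_gram_eq hRE hE (by linarith)
  -- Invertibility of `R` itself is needed first: substitution divides by its diagonal entries.
  have hdet := (isUnit_det_and_norm_inv_le_of_gram_eq (W := R) (δ := D * u) hA hRE hE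
    (by rw [sub_self, norm_zero]; positivity) hsmall).1
  have hdiag : ∀ i, R i i ≠ 0 := by
    rw [Matrix.det_of_isUpperTriangular (fun i j hij => htri i j hij)] at hdet
    intro i
    exact Finset.prod_ne_zero_iff.1 hdet.ne_zero i (Finset.mem_univ i)
  have hKu : K * u ≤ 1 / 2 := by linarith
  have hδ : ∀ M : Matrix (Fin n) (Fin n) ℝ, ‖M - R‖ ≤ n * (n * (2 * K * u * ‖R‖)) →
      ‖M - R‖ ≤ D * u * ‖A‖ := by
    intro M hM
    refine hM.trans ?_
    calc n * (n * (2 * K * u * ‖R‖)) ≤ n * (n * (2 * K * u * (2 * ‖A‖))) := by gcongr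
      _ = _ := by rw [hD]; ring
  obtain ⟨W, hW, hWy⟩ := hfs.exists_backward_error hu.le hu1
    (fun i j hij => htri j i hij) hdiag
  obtain ⟨V, hV, hVd⟩ := hbs.exists_backward_error hu.le hu1 htri hdiag
  have hWn : ‖Wᵀ - R‖ ≤ D * u * ‖A‖ :=
    hδ _ (norm_sub_le_of_factor hu.le hu1 hKu fun i j => hW j i)
  have hVn := hδ _ (norm_sub_le_of_factor hu.le hu1 hKu hV)
  have hmain := norm2_sub_le_of_seminormal_solve (g := g) hA hRE hE p3 (by linarith) p4 (by linarith)
    hsmall hWn hVn (by rw [Matrix.transpose_transpose]; exact hWy) hVd (xs - x)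
  have hnormal : (Aᵀ * A) *ᵥ (xs - x) = Aᵀ *ᵥ (b - A *ᵥ x) := by
    have h1 := hls.normal_equations
    rw [Matrix.mulVec_sub, sub_eq_zero] at h1
    rw [Matrix.mulVec_sub, Matrix.mulVec_sub, h1, Matrix.mulVec_mulVec, Matrix.mulVec_mulVec]
  have hf := hrhs u ur A b r x h g hu.le hu1.le hur.le hc₂ur hr hh hg
  rw [← hnormal] at hf
  have hAAe : norm2 ((Aᵀ * A) *ᵥ (xs - x)) ≤ ‖A‖ ^ 2 * norm2 (xs - x) := by
    rw [pow_two, ← l2_opNorm_transpose_mul_self]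
    exact norm2_mulVec_le _ _
  -- The form of the model relative to the computed result is used, which is why `‖x'‖` appears in
  -- the bound.
  have hround : norm2 (x' - (x + d)) ≤ u * norm2 x' := by
    rw [norm2_sub_rev]
    exact norm2_sub_le_of_forall_rounds hu.le fun j => by
      rw [abs_sub_comm]
      exact (hx' j).2
  calc norm2 (xs - x') = norm2 ((xs - x - d) - (x' - (x + d))) := by congr 1; abel
    _ ≤ norm2 (xs - x - d) + norm2 (x' - (x + d)) := norm2_sub_le _ _
    _ ≤ 4 * ‖pinv A‖ ^ 2 * ((3 * (C₁ * u) + 5 * (D * u)) * ‖A‖ ^ 2 * norm2 (xs - x)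
          + (u * (‖A‖ ^ 2 * norm2 (xs - x)) + C₂ * ur * ‖A‖ * (norm2 b + ‖A‖ * norm2 x)))
          + u * norm2 x' := by
      refine add_le_add (hmain.trans ?_) hround
      gcongr
      exact hf.trans (add_le_add (mul_le_mul_of_nonneg_left hAAe hu.le) le_rfl)
    _ = _ := by rw [kappa]; ring

/-! ### Contraction to the limiting accuracy -/

/-- The map `e ↦ e / 2 + a` has fixed point `2 a`, and the excess over it is at most halved each
time. The bound `4 a` leaves room to be reached after finitely many steps. -/
theorem eventually_le_of_contraction {E : ℕ → ℝ} {a : ℝ} (ha : 0 < a)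
    (h : ∀ i, E (i + 1) ≤ E i / 2 + a) : ∀ᶠ i in Filter.atTop, E i ≤ 4 * a := by
  have h1 : ∀ i, E i - 2 * a ≤ (1 / 2) ^ i * (E 0 - 2 * a) := by
    intro i
    induction i with
    | zero => simp
    | succ i ih =>
      rw [pow_succ]
      linarith [h i]
  have h2 : Filter.Tendsto (fun i : ℕ => (1 / 2 : ℝ) ^ i * (E 0 - 2 * a)) Filter.atTop
      (nhds (0 * (E 0 - 2 * a))) :=
    (tendsto_pow_atTop_nhds_zero_of_lt_one (by norm_num) (by norm_num)).mul_const _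
  rw [zero_mul] at h2
  filter_upwards [h2.eventually_le_const (show (0 : ℝ) < 2 * a by linarith)] with i hi
  linarith [h1 i]

/-- Contraction of the relative error, from the forward error bound of one step. -/
theorem relErr_succ_le {m n : ℕ} {A : Matrix (Fin m) (Fin n) ℝ} {b : Fin m → ℝ}
    {xs x x' : Fin n → ℝ} {u ur C₁ C₂ : ℝ} (hxs : xs ≠ 0) (hA : 0 < ‖A‖) (hu : 0 < u)
    (hu2 : u ≤ 1 / 2) (hur : 0 ≤ ur) (huru : ur ≤ u) (hC₂ : 0 ≤ C₂)
    (h : norm2 (xs - x') / norm2 xs ≤ C₁ * u * kappa A ^ 2 * (norm2 (xs - x) / norm2 xs)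
      + u * (norm2 x' / norm2 xs) + C₂ * ur * kappa A ^ 2 *
        ((‖A‖ * norm2 x + norm2 b) / (‖A‖ * norm2 xs))) :
    relErr xs x' ≤ 2 * (C₁ + C₂) * u * kappa A ^ 2 * relErr xs x
      + 2 * (u + C₂ * ur * kappa A ^ 2 * residualFactor A b xs) := by
  have hN : 0 < norm2 xs := (norm2_nonneg xs).lt_of_ne fun h => hxs (norm2_eq_zero.1 h.symm)
  have hdiv : ∀ z, norm2 z / norm2 xs ≤ 1 + relErr xs z := by
    intro z
    rw [relErr, div_le_iff₀ hN, add_mul, one_mul, div_mul_cancel₀ _ hN.ne']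
    calc norm2 z = norm2 (xs - (xs - z)) := by rw [sub_sub_cancel]
      _ ≤ _ := norm2_sub_le _ _
  have hb : norm2 b ≤ ‖A‖ * norm2 xs + norm2 (b - A *ᵥ xs) := by
    calc norm2 b = norm2 (A *ᵥ xs + (b - A *ᵥ xs)) := by rw [add_sub_cancel]
      _ ≤ _ := (norm2_add_le _ _).trans (add_le_add (norm2_mulVec_le A xs) le_rfl)
  -- The 2 in `residualFactor` arises here: one unit from `‖x‖ ≤ ‖xs‖ + ‖xs - x‖`, one from the part
  -- `A xs` of `b`.
  have hres : (‖A‖ * norm2 x + norm2 b) / (‖A‖ * norm2 xs)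
      ≤ relErr xs x + residualFactor A b xs := by
    calc (‖A‖ * norm2 x + norm2 b) / (‖A‖ * norm2 xs)
        ≤ (‖A‖ * norm2 x + (‖A‖ * norm2 xs + norm2 (b - A *ᵥ xs))) / (‖A‖ * norm2 xs) := by
          gcongr
      _ = norm2 x / norm2 xs + 1 + norm2 (b - A *ᵥ xs) / (‖A‖ * norm2 xs) := by
          field_simp
          ring
      _ ≤ _ := by
          rw [residualFactor]
          linarith [hdiv x]
  have hE0 : 0 ≤ relErr xs x := div_nonneg (norm2_nonneg _) hN.le
  have hE0' : 0 ≤ relErr xs x' := div_nonneg (norm2_nonneg _) hN.le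
  have hκ := sq_nonneg (kappa A)
  have h1 : C₂ * ur * kappa A ^ 2 * ((‖A‖ * norm2 x + norm2 b) / (‖A‖ * norm2 xs))
      ≤ C₂ * ur * kappa A ^ 2 * (relErr xs x + residualFactor A b xs) := by gcongr
  have h2 : u * (norm2 x' / norm2 xs) ≤ u * (1 + relErr xs x') := by
    gcongr
    exact hdiv x'
  -- The error-dependent share of the `ur` term joins the contraction factor. The share `u E'` of
  -- the rounding term is moved to the left, which costs the factor 2.
  have h3 : C₂ * ur * kappa A ^ 2 * relErr xs x ≤ C₂ * u * kappa A ^ 2 * relErr xs x := by gcongr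
  have h4 : u * relErr xs x' ≤ 1 / 2 * relErr xs x' := by gcongr
  change relErr xs x' ≤ C₁ * u * kappa A ^ 2 * relErr xs x + _ + _ at h
  linarith

end

/-! ### Main theorem: error recursion and limiting accuracy -/

theorem theorem1 (m n : ℕ) (hmn : n ≤ m) :
    ∃ c c₁ c₂ c₃ : ℝ, 0 < c ∧ 0 < c₁ ∧ 0 < c₂ ∧ 0 < c₃ ∧
      ∀ (u ur : ℝ) (A : Matrix (Fin m) (Fin n) ℝ) (b : Fin m → ℝ)
        (R : Matrix (Fin n) (Fin n) ℝ) (xs : Fin n → ℝ) (x : ℕ → Fin n → ℝ),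
        0 < u → 0 < ur → ur ≤ u ^ 2 →
        A.rank = n → c * u * kappa A < 1 →
        IsLeastSquaresSolution A b xs → xs ≠ 0 →
        FlHouseholderQR hmn u A R →
        (∀ i, FlSemiNormalStep u ur A b R (x i) (x (i + 1))) →
        -- the bound on the forward error of every iterate
        (∀ i, norm2 (xs - x (i + 1)) / norm2 xs ≤
            c₁ * u * kappa A ^ 2 * (norm2 (xs - x i) / norm2 xs)
              + u * (norm2 (x (i + 1)) / norm2 xs)
              + c₂ * ur * kappa A ^ 2 *
                  ((‖A‖ * norm2 (x i) + norm2 b) / (‖A‖ * norm2 xs))) ∧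
        (c₁ * u * kappa A ^ 2 < 1 →
          -- contraction down to the limiting accuracy
          (∀ i, relErr xs (x (i + 1)) ≤ c₁ * u * kappa A ^ 2 * relErr xs (x i) +
            c₃ * (u + c₂ * ur * kappa A ^ 2 * residualFactor A b xs)) ∧
          (∀ i, c₃ * (u + c₂ * ur * kappa A ^ 2 * residualFactor A b xs) < relErr xs (x i) →
            relErr xs (x (i + 1)) < relErr xs (x i)) ∧
          -- the limiting accuracy
          (∀ᶠ i in Filter.atTop, relErr xs (x i) ≤
            c₃ * (u + c₂ * ur * kappa A ^ 2 * residualFactor A b xs)) ∧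
          -- the limiting accuracy is of the order of the working precision
          (ur * kappa A ^ 2 * residualFactor A b xs < u →
            ∀ᶠ i in Filter.atTop, relErr xs (x i) ≤ c₃ * (1 + c₂) * u)) := by
  obtain ⟨c, C₁, C₂, hc, hC₁, hC₂, hstep⟩ := exists_seminormal_step_bound m n hmn
  -- `c₁` is twice the contraction factor `2 (C₁ + C₂)` of `relErr_succ_le`, so `c₁ u κ² < 1` makes
  -- the error at most halve up to `2 η`. Then `4 · 2 η` gives `c₃ = 8`.
  refine ⟨c, 4 * (C₁ + C₂), C₂, 8, by linarith, by positivity, hC₂, by norm_num, ?_⟩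
  intro u ur A b R xs x hu hur huru hA hcu hls hxs hQR hx
  have hκ := one_le_kappa hA hxs
  have hu2 : u ≤ 1 / 2 := by nlinarith [mul_le_mul_of_nonneg_right hc hu.le]
  have hurle : ur ≤ u := huru.trans (by nlinarith)
  have hA0 : 0 < ‖A‖ := (norm_nonneg A).lt_of_ne fun h => by
    rw [kappa, ← h] at hκ
    linarith
  have hN : 0 < norm2 xs := (norm2_nonneg xs).lt_of_ne fun h => hxs (norm2_eq_zero.1 h.symm)
  have hfwd : ∀ i, norm2 (xs - x (i + 1)) / norm2 xs ≤
      C₁ * u * kappa A ^ 2 * (norm2 (xs - x i) / norm2 xs)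
        + u * (norm2 (x (i + 1)) / norm2 xs)
        + C₂ * ur * kappa A ^ 2 * ((‖A‖ * norm2 (x i) + norm2 b) / (‖A‖ * norm2 xs)) := by
    intro i
    have h := hstep u ur A b R xs (x i) (x (i + 1)) hu hur huru hA hcu hls hxs hQR (hx i)
    refine (div_le_div_of_nonneg_right h hN.le).trans_eq ?_
    rw [kappa]
    field_simp
  have hE0 : ∀ i, 0 ≤ relErr xs (x i) := fun i => div_nonneg (norm2_nonneg _) hN.le
  have hcontr := fun i => relErr_succ_le hxs hA0 hu hu2 hur.le hurle hC₂.le (hfwd i)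
  have hρ : 0 ≤ residualFactor A b xs := by
    rw [residualFactor]
    have := norm2_nonneg (b - A *ᵥ xs)
    positivity
  set η := u + C₂ * ur * kappa A ^ 2 * residualFactor A b xs with hη
  have hη0 : 0 < η := by positivity
  refine ⟨fun i => (hfwd i).trans ?_, fun hlt => ?_⟩
  · have h1 : 0 ≤ u * kappa A ^ 2 * (norm2 (xs - x i) / norm2 xs) := by
      have := norm2_nonneg (xs - x i)
      positivity
    nlinarith [mul_nonneg hC₁.le h1, mul_nonneg hC₂.le h1]
  have hhalf : ∀ i, relErr xs (x (i + 1)) ≤ relErr xs (x i) / 2 + 2 * η := by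
    intro i
    have := mul_le_mul_of_nonneg_right hlt.le (hE0 i)
    linarith [hcontr i]
  have hev : ∀ᶠ i in Filter.atTop, relErr xs (x i) ≤ 8 * η := by
    filter_upwards [eventually_le_of_contraction
      (E := fun i => relErr xs (x i)) (a := 2 * η) (by positivity) hhalf] with i hi
    linarith
  refine ⟨fun i => ?_, fun i hi => by linarith [hhalf i], hev, fun hsmall => ?_⟩
  · have h1 : 0 ≤ 2 * (C₁ + C₂) * u * kappa A ^ 2 * relErr xs (x i) := by
      have := hE0 i
      positivity
    linarith [hcontr i]
  · filter_upwards [hev] with i hi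
    have := mul_le_mul_of_nonneg_left hsmall.le hC₂.le
    rw [hη] at hi
    linarith
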